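/- Let $\mathbf{k}$ be a field of characteristic zero and let $V=\bigoplus_{p\in\mathbb{Z}}V^p$ be a $\mathbb{Z}$-graded $\mathbf{k}$-vector space. For homogeneous elements $w_1,\dots,w_n$ of a graded vector space and $\sigma\in\mathfrak{S}_n$, let $\varepsilon(\sigma)=\prod_{a<b,\ \sigma(a)>\sigma(b)}(-1)^{|w_{\sigma(a)}||w_{\sigma(b)}|}$ be the Koszul sign and $\chi(\sigma)=\operatorname{sgn}(\sigma)\varepsilon(\sigma)$. Let $\mathfrak{S}_{(i,n-i)}$ be the set of $\sigma\in\mathfrak{S}_n$ with $\sigma(1)<\dots<\sigma(i)$ and $\sigma(i+1)<\dots<\sigma(n)$. An *$L_\infty$-algebra structure* on $V$ is a system of linear maps $l_k:V^{\otimes k}\to V$, $k\ge 1$, of degree $2-k$, such that for all homogeneous elements $l_k(v_{\sigma(1)},\dots,v_{\sigma(k)})=\chi(\sigma)\,l_k(v_1,\dots,v_k)$ for every $\sigma\in\mathfrak{S}_k$, and, for every $n\ge1$, $$\sum_{i+j=n+1}(-1)^i\sum_{\sigma\in\mathfrak{S}_{(i,n-i)}}\chi(\sigma)\,l_j\bigl(l_i(v_{\sigma(1)},\dots,v_{\sigma(i)}),v_{\sigma(i+1)},\dots,v_{\sigma(n)}\bigr)=0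 .$$ For a graded vector space $W$, let ${}^c\!\wedge(W)=\bigoplus_{n\ge1}\wedge^nW$, where $\wedge^nW$ is the quotient of $W^{\otimes n}$ by the relations $w_1\otimes\cdots\otimes w_n=\varepsilon(\sigma)\,w_{\sigma(1)}\otimes\cdots\otimes w_{\sigma(n)}$ ($w_i$ homogeneous, $\sigma\in\mathfrak S_n$), with the comultiplication $$\Delta(w_1\wedge\dots\wedge w_n)=\sum_{i=1}^{n-1}\sum_{\sigma\in\mathfrak{S}_{(i,n-i)}}\varepsilon(\sigma)\,(w_{\sigma(1)}\wedge\dots\wedge w_{\sigma(i)})\otimes(w_{\sigma(i+1)}\wedge\dots\wedge w_{\sigma(n)}) .$$ A *differential* on ${}^c\!\wedge(W)$ is a linear map $\theta$ of degree $1$ with $\Delta\theta=(\theta\otimes\mathrm{id})\Delta+(\mathrm{id}\otimes\theta)\Delta$, where $(\mathrm{id}\otimes\theta)(a\otimes b)=(-1)^{|a|}a\otimes\theta(b)$, and $\theta\circ\theta=0$. Its $n$-th *corestriction* is the composite $f_n:\wedge^nW\hookrightarrow{}^c\!\wedge(W)\xrightarrow{\ \theta\ }{}^c\!\wedge(W)\twoheadrightarrow\wedge^1W=W$.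 Let $\downarrow V$ be the desuspension, $(\downarrow V)^p=V^{p+1}$, with the tautological degree $-1$ map $\downarrow:V\to\,\downarrow V$. **Theorem.** There is a bijection between the set of $L_\infty$-algebra structures on $V$ and the set of differentials on ${}^c\!\wedge(\downarrow V)$, such that the structure $(l_1,l_2,\dots)$ corresponding to the differential with corestrictions $f_1,f_2,\dots$ is given, for every $n\ge1$ and all homogeneous $v_1,\dots,v_n\in V$, by $$\downarrow l_n(v_1,\dots,v_n)=(-1)^{\binom{n+1}{2}}\,(-1)^{\sum_{i=1}^n(n-i)|v_i|}\,f_n(\downarrow v_1\wedge\dots\wedge\downarrow v_n),$$ that is, $\downarrow\circ\, l_n=(-1)^{\binom{n+1}{2}}f_n\circ\downarrow^{\otimes n}$. -/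

import Mathlib

noncomputable section

open scoped TensorProduct DirectSum

namespace LInfty

/-! ### Koszul signs and unshuffles -/

/-- The Koszul sign `ε(σ)` for `n` homogeneous elements of degrees `d 0, …, d (n-1)`: the product of
`(-1)^{d (σ a) d (σ b)}` over all inversions `a < b`, `σ b < σ a` of `σ`. It is the sign with
`w₁ ∧ ⋯ ∧ wₙ = ε(σ) w_{σ 1} ∧ ⋯ ∧ w_{σ n}`. -/
def koszul {n : ℕ} (σ : Equiv.Perm (Fin n)) (d : Fin n → ℤ) : ℤˣ :=
  ∏ a, ∏ b, if a < b ∧ σ b < σ a then (d (σ a) * d (σ b)).negOnePow else 1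

/-- The antisymmetric Koszul sign `χ(σ) = sgn(σ) ε(σ)`. -/
def antiKoszul {n : ℕ} (σ : Equiv.Perm (Fin n)) (d : Fin n → ℤ) : ℤˣ :=
  Equiv.Perm.sign σ * koszul σ d

/-- The splitting of `n` positions into the first `i` ones and the last `n - i` ones. -/
def split (i n : ℕ) (h : i ≤ n) : Fin i ⊕ Fin (n - i) ≃ Fin n :=
  finSumFinEquiv.trans (finCongr (Nat.add_sub_cancel' h))

/-- The `(i, n-i)`-unshuffles: permutations which are increasing on the first `i` positions and
increasing on the last `n - i` positions. -/
def unshuffles (i n : ℕ) (h : i ≤ n) : Finset (Equiv.Perm (Fin n)) :=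
  Finset.univ.filter fun σ =>
    (∀ a b : Fin i, a < b → σ (split i n h (Sum.inl a)) < σ (split i n h (Sum.inl b))) ∧
    (∀ a b : Fin (n - i), a < b → σ (split i n h (Sum.inr a)) < σ (split i n h (Sum.inr b)))

section signs

variable {n : ℕ}

lemma prod_order_eq (r : Fin n → Fin n → ℤˣ) (hr : ∀ a b, r a b = r b a)
    (τ : Equiv.Perm (Fin n)) :
    (∏ a, ∏ b, if τ a < τ b then r a b else 1) = ∏ a, ∏ b, if a < b then r a b else 1 := by
  have h1 : (∏ a, ∏ b, if τ a < τ b then r a b else 1)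
      = (∏ a, ∏ b, if τ a < τ b ∧ a < b then r a b else 1) *
        ∏ a, ∏ b, if τ a < τ b ∧ b < a then r a b else 1 := by
    simp only [← Finset.prod_mul_distrib]
    refine Finset.prod_congr rfl fun a _ => Finset.prod_congr rfl fun b _ => ?_
    rcases lt_trichotomy a b with h | h | h
    · simp [h, h.not_gt]
    · subst h; simp
    · simp [h, h.not_gt]
  have h2 : (∏ a, ∏ b, if τ a < τ b ∧ b < a then r a b else 1)
      = ∏ a, ∏ b, if τ b < τ a ∧ a < b then r a b else 1 := by
    rw [Finset.prod_comm]
    refine Finset.prod_congr rfl fun a _ => Finset.prod_congr rfl fun b _ => ?_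
    rw [hr b a]
  rw [h1, h2]
  simp only [← Finset.prod_mul_distrib]
  refine Finset.prod_congr rfl fun a _ => Finset.prod_congr rfl fun b _ => ?_
  by_cases hab : a < b
  · have : τ a ≠ τ b := fun h => hab.ne (τ.injective h)
    rcases lt_or_gt_of_ne this with h | h
    · simp [h, h.not_gt, hab]
    · simp [h, h.not_gt, hab]
  · simp [hab]

lemma koszul_mul (τ σ : Equiv.Perm (Fin n)) (d : Fin n → ℤ) :
    koszul (τ * σ) d = koszul τ d * koszul σ (d ∘ τ) := by
  set h : Fin n → Fin n → ℤˣ := fun a b => (d (τ (σ a)) * d (τ (σ b))).negOnePow with hh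
  have hsymm : ∀ a b, h a b = h b a := fun a b => by simp only [hh, mul_comm]
  set k : Fin n → Fin n → ℤˣ := fun a b =>
    if (σ a < σ b ∧ τ (σ b) < τ (σ a)) ∨ (σ b < σ a ∧ τ (σ a) < τ (σ b)) then h a b else 1 with hk
  have ksymm : ∀ a b, k a b = k b a := fun a b => by
    simp only [hk]
    rw [hsymm a b]
    congr 1
    exact propext or_comm
  have h1 : koszul τ d = ∏ a, ∏ b, if a < b then k a b else 1 := by
    rw [← prod_order_eq k ksymm σ]
    unfold koszul
    rw [← Equiv.prod_comp σ]
    refine Finset.prod_congr rfl fun a _ => ?_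
    rw [← Equiv.prod_comp σ]
    refine Finset.prod_congr rfl fun b _ => ?_
    by_cases hab : σ a < σ b
    · simp [hk, hh, hab, hab.not_gt]
    · simp [hab]
  rw [h1]
  unfold koszul
  simp only [← Finset.prod_mul_distrib]
  refine Finset.prod_congr rfl fun a _ => Finset.prod_congr rfl fun b _ => ?_
  by_cases hab : a < b
  · have n1 : σ a ≠ σ b := fun e => hab.ne (σ.injective e)
    have n2 : τ (σ a) ≠ τ (σ b) := fun e => n1 (τ.injective e)
    rcases lt_or_gt_of_ne n1 with h3 | h3 <;> rcases lt_or_gt_of_ne n2 with h4 | h4 <;>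
      simp [hk, hh, hab, h3, h4, h3.not_gt, h4.not_gt]
  · simp [hab]

lemma koszul_one (d : Fin n → ℤ) : koszul 1 d = 1 := by
  unfold koszul
  refine Finset.prod_eq_one fun a _ => Finset.prod_eq_one fun b _ => ?_
  rw [if_neg]
  rintro ⟨h1, h2⟩
  exact lt_asymm h1 h2

/-- The block permutation acting by `π₁` on the first `i` and by `π₂` on the last positions. -/
def block {i n : ℕ} (h : i ≤ n) (π₁ : Equiv.Perm (Fin i)) (π₂ : Equiv.Perm (Fin (n - i))) :
    Equiv.Perm (Fin n) :=
  (split i n h).permCongr (Equiv.Perm.sumCongr π₁ π₂)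

lemma block_inl {i n : ℕ} (h : i ≤ n) (π₁ : Equiv.Perm (Fin i)) (π₂ : Equiv.Perm (Fin (n - i)))
    (a : Fin i) : block h π₁ π₂ (split i n h (Sum.inl a)) = split i n h (Sum.inl (π₁ a)) := by
  simp [block, Equiv.permCongr_apply]

lemma block_inr {i n : ℕ} (h : i ≤ n) (π₁ : Equiv.Perm (Fin i)) (π₂ : Equiv.Perm (Fin (n - i)))
    (a : Fin (n - i)) : block h π₁ π₂ (split i n h (Sum.inr a)) = split i n h (Sum.inr (π₂ a)) := by
  simp [block, Equiv.permCongr_apply]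

lemma split_inl_val {i n : ℕ} (h : i ≤ n) (a : Fin i) : (split i n h (Sum.inl a)).val = a := by
  simp [split]

lemma split_inr_val {i n : ℕ} (h : i ≤ n) (a : Fin (n - i)) :
    (split i n h (Sum.inr a)).val = i + a := by
  simp [split]

lemma koszul_block {i n : ℕ} (h : i ≤ n) (π₁ : Equiv.Perm (Fin i))
    (π₂ : Equiv.Perm (Fin (n - i))) (d : Fin n → ℤ) :
    koszul (block h π₁ π₂) d =
      koszul π₁ (fun a => d (split i n h (Sum.inl a))) *
        koszul π₂ (fun a => d (split i n h (Sum.inr a))) := by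
  unfold koszul
  rw [← Equiv.prod_comp (split i n h), Fintype.prod_sum_type]
  congr 1
  · refine Finset.prod_congr rfl fun a _ => ?_
    rw [← Equiv.prod_comp (split i n h), Fintype.prod_sum_type]
    rw [Finset.prod_eq_one (s := (Finset.univ : Finset (Fin (n - i)))), mul_one]
    · refine Finset.prod_congr rfl fun b _ => ?_
      simp only [block_inl, Fin.lt_def, split_inl_val]
    · intro b _
      rw [if_neg]
      simp only [block_inl, block_inr, Fin.lt_def, split_inl_val, split_inr_val]
      omega
  · refine Finset.prod_congr rfl fun a _ => ?_
    rw [← Equiv.prod_comp (split i n h), Fintype.prod_sum_type]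
    rw [Finset.prod_eq_one (s := (Finset.univ : Finset (Fin i))), one_mul]
    · refine Finset.prod_congr rfl fun b _ => ?_
      simp only [block_inr, Fin.lt_def, split_inr_val, add_lt_add_iff_left]
    · intro b _
      rw [if_neg]
      simp only [block_inl, block_inr, Fin.lt_def, split_inl_val, split_inr_val]
      omega

lemma exists_sort {i : ℕ} {α : Type*} [LinearOrder α] (f : Fin i → α) (hf : Function.Injective f) :
    ∃ π : Equiv.Perm (Fin i), ∀ a b, a < b → f (π a) < f (π b) := by
  refine ⟨Tuple.sort f, fun a b hab => ?_⟩
  exact ((Tuple.monotone_sort f).strictMono_of_injective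
    (hf.comp (Tuple.sort f).injective)) hab

lemma exists_unshuffle {i n : ℕ} (h : i ≤ n) (ρ : Equiv.Perm (Fin n)) :
    ∃ π₁ π₂, ρ * block h π₁ π₂ ∈ unshuffles i n h := by
  obtain ⟨π₁, h1⟩ := exists_sort (fun a => ρ (split i n h (Sum.inl a)))
    (fun a b hab => by simpa using hab)
  obtain ⟨π₂, h2⟩ := exists_sort (fun a => ρ (split i n h (Sum.inr a)))
    (fun a b hab => by simpa using hab)
  refine ⟨π₁, π₂, ?_⟩
  simp only [unshuffles, Finset.mem_filter, Finset.mem_univ, true_and, Equiv.Perm.mul_apply,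
    block_inl, block_inr]
  exact ⟨h1, h2⟩

lemma block_mul {i n : ℕ} (h : i ≤ n) (π₁ π₁' : Equiv.Perm (Fin i))
    (π₂ π₂' : Equiv.Perm (Fin (n - i))) :
    block h π₁ π₂ * block h π₁' π₂' = block h (π₁ * π₁') (π₂ * π₂') := by
  refine Equiv.ext fun x => ?_
  obtain ⟨y, rfl⟩ := (split i n h).surjective x
  rcases y with a | a <;> simp [block_inl, block_inr]

lemma block_one {i n : ℕ} (h : i ≤ n) : block h 1 1 = 1 := by
  refine Equiv.ext fun x => ?_
  obtain ⟨y, rfl⟩ := (split i n h).surjective x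
  rcases y with a | a <;> simp [block_inl, block_inr]

lemma perm_eq_one_of_lt {i : ℕ} (f g : Fin i → Fin n) (π : Equiv.Perm (Fin i))
    (hf : ∀ a b, a < b → f a < f b) (hg : ∀ a b, a < b → g a < g b)
    (hfg : ∀ a, g a = f (π a)) : π = 1 := by
  have h1 : StrictMono f := fun a b => hf a b
  have h2 : StrictMono g := fun a b => hg a b
  have : StrictMono π := fun a b hab => by
    have := h2 hab
    rw [hfg, hfg] at this
    exact h1.lt_iff_lt.mp this
  refine Equiv.ext fun a => ?_
  have e := Subsingleton.elim (this.orderIsoOfSurjective π π.surjective) (OrderIso.refl (Fin i))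
  exact congrArg (fun q : Fin i ≃o Fin i => q a) e

lemma unshuffle_unique {i n : ℕ} (h : i ≤ n) {σ : Equiv.Perm (Fin n)} (π₁ π₂)
    (h1 : σ ∈ unshuffles i n h) (h2 : σ * block h π₁ π₂ ∈ unshuffles i n h) :
    σ * block h π₁ π₂ = σ := by
  simp only [unshuffles, Finset.mem_filter, Finset.mem_univ, true_and, Equiv.Perm.mul_apply,
    block_inl, block_inr] at h1 h2
  have e1 : π₁ = 1 := perm_eq_one_of_lt (fun a => σ (split i n h (Sum.inl a))) _ π₁ h1.1 h2.1
    fun a => rfl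
  have e2 : π₂ = 1 := perm_eq_one_of_lt (fun a => σ (split i n h (Sum.inr a))) _ π₂ h1.2 h2.2
    fun a => rfl
  rw [e1, e2, block_one, mul_one]

/-- A sum over unshuffles of a function that is invariant under block permutations does not change
under left translation. -/
lemma sum_unshuffles_mul {M : Type*} [AddCommMonoid M] {i n : ℕ} (h : i ≤ n)
    (F : Equiv.Perm (Fin n) → M) (hF : ∀ ρ π₁ π₂, F (ρ * block h π₁ π₂) = F ρ)
    (τ : Equiv.Perm (Fin n)) :
    ∑ σ ∈ unshuffles i n h, F (τ * σ) = ∑ σ ∈ unshuffles i n h, F σ := by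
  choose p q hpq using exists_unshuffle h
  have key : ∀ τ : Equiv.Perm (Fin n), ∀ σ ∈ unshuffles i n h,
      τ⁻¹ * (τ * σ * block h (p (τ * σ)) (q (τ * σ))) *
        block h (p (τ⁻¹ * (τ * σ * block h (p (τ * σ)) (q (τ * σ)))))
          (q (τ⁻¹ * (τ * σ * block h (p (τ * σ)) (q (τ * σ))))) = σ := by
    intro τ σ hσ
    have hm := hpq (τ⁻¹ * (τ * σ * block h (p (τ * σ)) (q (τ * σ))))
    revert hm
    generalize p (τ⁻¹ * (τ * σ * block h (p (τ * σ)) (q (τ * σ)))) = a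
    generalize q (τ⁻¹ * (τ * σ * block h (p (τ * σ)) (q (τ * σ)))) = b
    have e : τ⁻¹ * (τ * σ * block h (p (τ * σ)) (q (τ * σ))) * block h a b
        = σ * block h (p (τ * σ) * a) (q (τ * σ) * b) := by
      rw [← block_mul]; group
    rw [e]
    exact unshuffle_unique h _ _ hσ
  refine Finset.sum_bij' (fun σ _ => τ * σ * block h (p (τ * σ)) (q (τ * σ)))
    (fun σ _ => τ⁻¹ * σ * block h (p (τ⁻¹ * σ)) (q (τ⁻¹ * σ)))
    (fun σ _ => hpq _) (fun σ _ => hpq _) (fun σ hσ => key τ σ hσ) (fun σ hσ => ?_)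
    (fun σ _ => (hF _ _ _).symm)
  have := key τ⁻¹ σ hσ
  rwa [inv_inv] at this

end signs

/-! ### The coalgebra `ᶜ∧(W)` -/

section coalgebra

variable {K : Type*} [Field K] {W : Type*} [AddCommGroup W] [Module K W]

/-- The graded-symmetric relations in the `n`-th tensor power:
`w₁ ⊗ ⋯ ⊗ wₙ - ε(σ) w_{σ 1} ⊗ ⋯ ⊗ w_{σ n}` for homogeneous `w₁, …, wₙ`. -/
def symRel (𝒲 : ℤ → Submodule K W) (n : ℕ) : Submodule K (⨂[K] _ : Fin n, W) :=
  Submodule.span K {x | ∃ (d : Fin n → ℤ) (w : Fin n → W) (σ : Equiv.Perm (Fin n)),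
    (∀ i, w i ∈ 𝒲 (d i)) ∧
    x = PiTensorProduct.tprod K w - koszul σ d • PiTensorProduct.tprod K (w ∘ σ)}

/-- `∧ⁿ W`, the `n`-th homogeneous piece of the free graded commutative algebra on `W`. -/
def ExtPow (𝒲 : ℤ → Submodule K W) (n : ℕ) : Type _ := (⨂[K] _ : Fin n, W) ⧸ symRel 𝒲 n

instance (𝒲 : ℤ → Submodule K W) (n : ℕ) : AddCommGroup (ExtPow 𝒲 n) :=
  inferInstanceAs (AddCommGroup ((⨂[K] _ : Fin n, W) ⧸ symRel 𝒲 n))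

instance (𝒲 : ℤ → Submodule K W) (n : ℕ) : Module K (ExtPow 𝒲 n) :=
  inferInstanceAs (Module K ((⨂[K] _ : Fin n, W) ⧸ symRel 𝒲 n))

/-- The quotient map `W^{⊗n} → ∧ⁿ W`. -/
def ExtPow.mk (𝒲 : ℤ → Submodule K W) (n : ℕ) : (⨂[K] _ : Fin n, W) →ₗ[K] ExtPow 𝒲 n :=
  (symRel 𝒲 n).mkQ

/-- The underlying space `⨁_{n ≥ 1} ∧ⁿ W` of the (non-counital) coalgebra `ᶜ∧(W)`. -/
def CExt (𝒲 : ℤ → Submodule K W) : Type _ := ⨁ n : ℕ+, ExtPow 𝒲 n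

instance (𝒲 : ℤ → Submodule K W) : AddCommGroup (CExt 𝒲) :=
  inferInstanceAs (AddCommGroup (⨁ n : ℕ+, ExtPow 𝒲 n))

instance (𝒲 : ℤ → Submodule K W) : Module K (CExt 𝒲) :=
  inferInstanceAs (Module K (⨁ n : ℕ+, ExtPow 𝒲 n))

/-- The inclusion `∧ⁿ W → ᶜ∧(W)`. -/
def CExt.incl (𝒲 : ℤ → Submodule K W) (n : ℕ+) : ExtPow 𝒲 n →ₗ[K] CExt 𝒲 :=
  DirectSum.lof K ℕ+ (fun m : ℕ+ => ExtPow 𝒲 m) n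

/-- The projection `ᶜ∧(W) → ∧ⁿ W`. -/
def CExt.component (𝒲 : ℤ → Submodule K W) (n : ℕ+) : CExt 𝒲 →ₗ[K] ExtPow 𝒲 n :=
  DirectSum.component K ℕ+ (fun m : ℕ+ => ExtPow 𝒲 m) n

/-- The linear map on `ᶜ∧(W)` with given restrictions to the summands `∧ⁿ W`. -/
def CExt.lift (𝒲 : ℤ → Submodule K W) {N : Type*} [AddCommGroup N] [Module K N]
    (f : ∀ n : ℕ+, ExtPow 𝒲 n →ₗ[K] N) : CExt 𝒲 →ₗ[K] N :=
  DirectSum.toModule K ℕ+ N f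

lemma CExt.lift_incl (𝒲 : ℤ → Submodule K W) {N : Type*} [AddCommGroup N] [Module K N]
    (f : ∀ n : ℕ+, ExtPow 𝒲 n →ₗ[K] N) (n : ℕ+) (x : ExtPow 𝒲 n) :
    CExt.lift 𝒲 f (CExt.incl 𝒲 n x) = f n x := by
  have h := DirectSum.toModule_lof K (M := fun m : ℕ+ => ExtPow 𝒲 m) (φ := f) n x
  exact h

/-- `w₁ ∧ ⋯ ∧ wₙ` as a multilinear function with values in `ᶜ∧(W)`. -/
def wedge (𝒲 : ℤ → Submodule K W) (n : ℕ+) :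
    MultilinearMap K (fun _ : Fin n => W) (CExt 𝒲) :=
  (CExt.incl 𝒲 n ∘ₗ ExtPow.mk 𝒲 n).compMultilinearMap
    (PiTensorProduct.tprod K)

lemma wedge_perm (𝒲 : ℤ → Submodule K W) (n : ℕ+) (d : Fin n → ℤ) (w : Fin n → W)
    (hw : ∀ i, w i ∈ 𝒲 (d i)) (σ : Equiv.Perm (Fin n)) :
    wedge 𝒲 n w = koszul σ d • wedge 𝒲 n (w ∘ σ) := by
  have h : ExtPow.mk 𝒲 n (PiTensorProduct.tprod K w)
      = ExtPow.mk 𝒲 n (koszul σ d • PiTensorProduct.tprod K (w ∘ σ)) := by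
    rw [← sub_eq_zero, ← map_sub]
    exact (Submodule.Quotient.mk_eq_zero _).mpr (Submodule.subset_span ⟨d, w, σ, hw, rfl⟩)
  simp only [wedge, LinearMap.compMultilinearMap_apply, LinearMap.comp_apply]
  rw [h, Units.smul_def, map_zsmul, map_zsmul, Units.smul_def]

/-- The part of `ᶜ∧(W)` of degree `p`, where `|w₁ ∧ ⋯ ∧ wₙ| = |w₁| + ⋯ + |wₙ|`. -/
def extDeg (𝒲 : ℤ → Submodule K W) (p : ℤ) : Submodule K (CExt 𝒲) :=
  Submodule.span K {x | ∃ (n : ℕ+) (d : Fin n → ℤ) (w : Fin n → W),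
    (∀ i, w i ∈ 𝒲 (d i)) ∧ ∑ i, d i = p ∧ x = wedge 𝒲 n w}

/-- The linear projection `ᶜ∧(W) → ∧¹ W = W`. -/
def proj (𝒲 : ℤ → Submodule K W) : CExt 𝒲 →ₗ[K] W :=
  (show ExtPow 𝒲 (1 : ℕ+) →ₗ[K] W from Submodule.liftQ (symRel 𝒲 (1 : ℕ+))
    (PiTensorProduct.lift (MultilinearMap.ofSubsingleton K W W (0 : Fin 1) LinearMap.id)) (by
      refine Submodule.span_le.mpr ?_
      rintro _ ⟨d, w, σ, -, rfl⟩
      have : σ = 1 := @Subsingleton.elim (Equiv.Perm (Fin 1)) _ _ _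
      subst this
      have e : koszul (1 : Equiv.Perm (Fin (1 : ℕ+))) d = 1 := koszul_one d
      rw [SetLike.mem_coe, LinearMap.mem_ker, e, one_smul]
      exact (congrArg _ (sub_self _)).trans (map_zero _))) ∘ₗ
  CExt.component 𝒲 1

lemma proj_wedge_one (𝒲 : ℤ → Submodule K W) (w : Fin (1 : ℕ+) → W) :
    proj 𝒲 (wedge 𝒲 1 w) = w (0 : Fin 1) := by
  have h : CExt.component 𝒲 1 (wedge 𝒲 1 w) = ExtPow.mk 𝒲 _ (PiTensorProduct.tprod K w) :=
    DirectSum.component.lof_self K (M := fun m : ℕ+ => ExtPow 𝒲 m) 1 _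
  rw [proj, LinearMap.comp_apply, h]
  exact PiTensorProduct.lift.tprod _

lemma proj_wedge_of_ne (𝒲 : ℤ → Submodule K W) (n : ℕ+) (hn : n ≠ 1) (w : Fin n → W) :
    proj 𝒲 (wedge 𝒲 n w) = 0 := by
  have h : CExt.component 𝒲 1 (wedge 𝒲 n w) = 0 :=
    (DirectSum.component.of K (M := fun m : ℕ+ => ExtPow 𝒲 m) 1 n _).trans (dif_neg hn)
  rw [proj, LinearMap.comp_apply, h, map_zero]

variable {N : Type*} [AddCommGroup N] [Module K N]

/-- The multilinear map on `W` which agrees with `φ d` on homogeneous elements of degrees `d`. -/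
def homExt (𝒲 : ℤ → Submodule K W) [DirectSum.Decomposition 𝒲] {n : ℕ}
    (φ : (Fin n → ℤ) → MultilinearMap K (fun _ : Fin n => W) N) :
    MultilinearMap K (fun _ : Fin n => W) N :=
  (MultilinearMap.fromDirectSumEquiv (R := K) (κ := fun _ : Fin n => ℤ) (M := fun _ p => 𝒲 p)
    (fun d => (φ d).compLinearMap fun i => (𝒲 (d i)).subtype)).compLinearMap
    fun _ => (DirectSum.decomposeLinearEquiv 𝒲).toLinearMap

lemma homExt_apply (𝒲 : ℤ → Submodule K W) [DirectSum.Decomposition 𝒲] {n : ℕ}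
    (φ : (Fin n → ℤ) → MultilinearMap K (fun _ : Fin n => W) N) (d : Fin n → ℤ) (w : Fin n → W)
    (hw : ∀ i, w i ∈ 𝒲 (d i)) : homExt 𝒲 φ w = φ d w := by
  have : (fun i => DirectSum.decompose 𝒲 (w i))
      = fun i => DirectSum.lof K ℤ (fun p => 𝒲 p) (d i) ⟨w i, hw i⟩ := by
    funext i
    exact DirectSum.decompose_of_mem 𝒲 (hw i)
  simp only [homExt, MultilinearMap.compLinearMap_apply, LinearEquiv.coe_coe,
    DirectSum.decomposeLinearEquiv_apply]
  rw [this, MultilinearMap.fromDirectSumEquiv_lof]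
  rfl

/-- A linear map out of `∧ⁿ W` given by a graded-symmetric family of multilinear maps. -/
def extLift (𝒲 : ℤ → Submodule K W) [DirectSum.Decomposition 𝒲] (n : ℕ)
    (φ : (Fin n → ℤ) → MultilinearMap K (fun _ : Fin n => W) N)
    (hφ : ∀ d w σ, (∀ i, w i ∈ 𝒲 (d i)) → φ d w = koszul σ d • φ (d ∘ σ) (w ∘ σ)) :
    ExtPow 𝒲 n →ₗ[K] N :=
  show (⨂[K] _ : Fin n, W) ⧸ symRel 𝒲 n →ₗ[K] N from
  Submodule.liftQ (symRel 𝒲 n) (PiTensorProduct.lift (homExt 𝒲 φ)) (by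
    refine Submodule.span_le.mpr ?_
    rintro _ ⟨d, w, σ, hw, rfl⟩
    rw [SetLike.mem_coe, LinearMap.mem_ker, map_sub, Units.smul_def, map_zsmul,
      PiTensorProduct.lift.tprod, PiTensorProduct.lift.tprod, homExt_apply 𝒲 φ d w hw,
      homExt_apply 𝒲 φ (d ∘ σ) (w ∘ σ) (fun i => hw (σ i)), hφ d w σ hw, Units.smul_def, sub_self])

lemma extLift_mk (𝒲 : ℤ → Submodule K W) [DirectSum.Decomposition 𝒲] (n : ℕ)
    (φ : (Fin n → ℤ) → MultilinearMap K (fun _ : Fin n => W) N) (hφ) (d : Fin n → ℤ)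
    (w : Fin n → W) (hw : ∀ i, w i ∈ 𝒲 (d i)) :
    extLift 𝒲 n φ hφ (ExtPow.mk 𝒲 n (PiTensorProduct.tprod K w)) = φ d w := by
  have h := homExt_apply 𝒲 φ d w hw
  rw [← PiTensorProduct.lift.tprod] at h
  exact h

/-- `(w₁, …, wₙ) ↦ (w_{σ 1} ∧ ⋯ ∧ w_{σ i}) ⊗ (w_{σ (i+1)} ∧ ⋯ ∧ w_{σ n})` for `0 < i < n`. -/
def wedgeTensor (𝒲 : ℤ → Submodule K W) (n i : ℕ) (hi : 0 < i) (hin : i < n)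
    (σ : Equiv.Perm (Fin n)) :
    MultilinearMap K (fun _ : Fin n => W) (CExt 𝒲 ⊗[K] CExt 𝒲) :=
  (MultilinearMap.domCoprod (wedge 𝒲 ⟨i, hi⟩)
    (wedge 𝒲 ⟨n - i, Nat.sub_pos_of_lt hin⟩)).domDomCongr ((split i n hin.le).trans σ)

lemma wedgeTensor_apply (𝒲 : ℤ → Submodule K W) (n i : ℕ) (hi : 0 < i) (hin : i < n)
    (σ : Equiv.Perm (Fin n)) (w : Fin n → W) :
    wedgeTensor 𝒲 n i hi hin σ w =
      wedge 𝒲 ⟨i, hi⟩ (fun a => w (σ (split i n hin.le (Sum.inl a)))) ⊗ₜ[K]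
        wedge 𝒲 ⟨n - i, Nat.sub_pos_of_lt hin⟩
          (fun b => w (σ (split i n hin.le (Sum.inr b)))) := rfl

/-- For degrees `d`, the multilinear map
`(w₁, …, wₙ) ↦ ∑_{0 < i < n} ∑_σ ε(σ) (w_{σ 1} ∧ ⋯ ∧ w_{σ i}) ⊗ (w_{σ (i+1)} ∧ ⋯ ∧ w_{σ n})`
where `σ` runs through the `(i, n-i)`-unshuffles (below, `i` is written as `i + 1`). -/
def comulFamily (𝒲 : ℤ → Submodule K W) (n : ℕ) (d : Fin n → ℤ) :
    MultilinearMap K (fun _ : Fin n => W) (CExt 𝒲 ⊗[K] CExt 𝒲) :=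
  ∑ i : Fin (n - 1), ∑ σ ∈ unshuffles (i + 1) n (by omega),
    koszul σ d • wedgeTensor 𝒲 n (i + 1) (by omega) (by omega) σ

lemma wedgeTensor_block (𝒲 : ℤ → Submodule K W) (n i : ℕ) (hi : 0 < i) (hin : i < n)
    (ρ : Equiv.Perm (Fin n)) (π₁ : Equiv.Perm (Fin i)) (π₂ : Equiv.Perm (Fin (n - i)))
    (d : Fin n → ℤ) (w : Fin n → W) (hw : ∀ i, w i ∈ 𝒲 (d i)) :
    koszul (ρ * block hin.le π₁ π₂) d • wedgeTensor 𝒲 n i hi hin (ρ * block hin.le π₁ π₂) w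
      = koszul ρ d • wedgeTensor 𝒲 n i hi hin ρ w := by
  have h1 := wedge_perm 𝒲 ⟨i, hi⟩ (fun a => d (ρ (split i n hin.le (Sum.inl a))))
    (fun a => w (ρ (split i n hin.le (Sum.inl a)))) (fun a => hw _) π₁
  have h2 := wedge_perm 𝒲 ⟨n - i, Nat.sub_pos_of_lt hin⟩
    (fun a => d (ρ (split i n hin.le (Sum.inr a))))
    (fun a => w (ρ (split i n hin.le (Sum.inr a)))) (fun a => hw _) π₂
  have e1 : (fun a : Fin i => w ((ρ * block hin.le π₁ π₂) (split i n hin.le (Sum.inl a))))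
      = (fun a => w (ρ (split i n hin.le (Sum.inl a)))) ∘ π₁ := by
    funext a
    simp only [Equiv.Perm.mul_apply, block_inl, Function.comp_apply]
  have e2 : (fun a : Fin (n - i) => w ((ρ * block hin.le π₁ π₂) (split i n hin.le (Sum.inr a))))
      = (fun a => w (ρ (split i n hin.le (Sum.inr a)))) ∘ π₂ := by
    funext a
    simp only [Equiv.Perm.mul_apply, block_inr, Function.comp_apply]
  have e1' := congrArg (wedge 𝒲 ⟨i, hi⟩) e1
  have e2' := congrArg (wedge 𝒲 ⟨n - i, Nat.sub_pos_of_lt hin⟩) e2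
  rw [wedgeTensor_apply, wedgeTensor_apply, koszul_mul, koszul_block, h1, h2]
  refine (congrArg₂ (fun x y => (koszul ρ d * (koszul π₁ _ * koszul π₂ _)) • (x ⊗ₜ[K] y))
    e1' e2').trans ?_
  simp only [Units.smul_def, ← Int.cast_smul_eq_zsmul K, TensorProduct.smul_tmul',
    TensorProduct.tmul_smul, smul_smul]
  push_cast
  congr 2
  exact congrArg _ (mul_comm _ _)

lemma comulFamily_perm (𝒲 : ℤ → Submodule K W) (n : ℕ) (d : Fin n → ℤ) (w : Fin n → W)
    (τ : Equiv.Perm (Fin n)) (hw : ∀ i, w i ∈ 𝒲 (d i)) :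
    comulFamily 𝒲 n d w = koszul τ d • comulFamily 𝒲 n (d ∘ τ) (w ∘ τ) := by
  simp only [comulFamily, sum_apply, Finset.smul_sum]
  refine Finset.sum_congr rfl fun i _ => ?_
  have hin : (i : ℕ) + 1 < n := by omega
  rw [← sum_unshuffles_mul hin.le
    (fun σ => (koszul σ d • wedgeTensor 𝒲 n (i + 1) (Nat.succ_pos _) hin σ) w)
    (fun ρ π₁ π₂ => wedgeTensor_block 𝒲 n (i + 1) (Nat.succ_pos _) hin ρ π₁ π₂ d w hw) τ]
  refine Finset.sum_congr rfl fun σ _ => ?_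
  rw [koszul_mul, mul_smul]
  rfl

/-- The comultiplication `Δ : ᶜ∧(W) → ᶜ∧(W) ⊗ ᶜ∧(W)`. -/
def comul (𝒲 : ℤ → Submodule K W) [DirectSum.Decomposition 𝒲] :
    CExt 𝒲 →ₗ[K] CExt 𝒲 ⊗[K] CExt 𝒲 :=
  CExt.lift 𝒲 fun n =>
    extLift 𝒲 n (comulFamily 𝒲 n) fun d w σ hw => comulFamily_perm 𝒲 n d w σ hw

/-- The defining formula of the comultiplication. -/
theorem comul_wedge (𝒲 : ℤ → Submodule K W) [DirectSum.Decomposition 𝒲] (n : ℕ+)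
    (d : Fin n → ℤ) (w : Fin n → W) (hw : ∀ i, w i ∈ 𝒲 (d i)) :
    comul 𝒲 (wedge 𝒲 n w) =
      ∑ i : Fin ((n : ℕ) - 1), ∑ σ ∈ unshuffles (i + 1) n (by omega), koszul σ d •
        (wedge 𝒲 ⟨i + 1, by omega⟩ (fun a => w (σ (split (i + 1) n (by omega) (Sum.inl a)))) ⊗ₜ[K]
          wedge 𝒲 ⟨n - (i + 1), by omega⟩
            (fun b => w (σ (split (i + 1) n (by omega) (Sum.inr b))))) := by
  simp only [comul, wedge, LinearMap.compMultilinearMap_apply, LinearMap.comp_apply,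
    CExt.lift_incl]
  rw [extLift_mk 𝒲 n _ _ d w hw]
  simp only [comulFamily, sum_apply]
  rfl

/-- The linear operator on `ᶜ∧(W)` multiplying elements of degree `p` by `(-1)^{k p}`. -/
def koszulOp (𝒲 : ℤ → Submodule K W) [DirectSum.Decomposition 𝒲] (k : ℤ) :
    CExt 𝒲 →ₗ[K] CExt 𝒲 :=
  CExt.lift 𝒲 fun n =>
    extLift 𝒲 n (fun d => (k * ∑ i, d i).negOnePow • wedge 𝒲 n) fun d w σ hw => by
      simp only [smul_apply, Function.comp_apply, Equiv.sum_comp σ d]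
      rw [wedge_perm 𝒲 n d w hw σ, smul_comm]

theorem koszulOp_of_mem (𝒲 : ℤ → Submodule K W) [DirectSum.Decomposition 𝒲] (k p : ℤ)
    (c : CExt 𝒲) (hc : c ∈ extDeg 𝒲 p) : koszulOp 𝒲 k c = (k * p).negOnePow • c := by
  have : extDeg 𝒲 p ≤ LinearMap.eqLocus (koszulOp 𝒲 k)
      (((k * p).negOnePow : ℤ) • (LinearMap.id : CExt 𝒲 →ₗ[K] CExt 𝒲)) := by
    refine Submodule.span_le.mpr ?_
    rintro _ ⟨n, d, w, hw, rfl, rfl⟩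
    simp only [SetLike.mem_coe, LinearMap.mem_eqLocus, LinearMap.smul_apply, LinearMap.id_apply]
    conv_lhs => simp only [koszulOp, wedge, LinearMap.compMultilinearMap_apply,
      LinearMap.comp_apply, CExt.lift_incl]
    rw [extLift_mk 𝒲 n _ _ d w hw]
    rfl
  exact this hc

/-- A degree `k` coderivation of `ᶜ∧(W)`: a degree `k` linear map `θ` with
`Δ θ = (θ ⊗ id) Δ + (id ⊗ θ) Δ`, where by the Koszul sign convention
`(id ⊗ θ)(a ⊗ b) = (-1)^{k |a|} a ⊗ θ b`. -/
structure IsCoderivation (𝒲 : ℤ → Submodule K W) [DirectSum.Decomposition 𝒲] (k : ℤ)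
    (θ : CExt 𝒲 →ₗ[K] CExt 𝒲) : Prop where
  degree : ∀ p, ∀ c ∈ extDeg 𝒲 p, θ c ∈ extDeg 𝒲 (p + k)
  leibniz : ∀ c, comul 𝒲 (θ c) =
    TensorProduct.map θ LinearMap.id (comul 𝒲 c) +
      TensorProduct.map (koszulOp 𝒲 k) θ (comul 𝒲 c)

/-- The set of differentials on `ᶜ∧(W)`: degree `1` coderivations of square zero. -/
def CoDiff (𝒲 : ℤ → Submodule K W) [DirectSum.Decomposition 𝒲] :
    Set (CExt 𝒲 →ₗ[K] CExt 𝒲) :=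
  {θ | IsCoderivation 𝒲 1 θ ∧ θ ∘ₗ θ = 0}

/-- The `n`-th corestriction of `θ`, as a multilinear function of `w₁, …, wₙ`: the component in
`∧¹ W = W` of `θ (w₁ ∧ ⋯ ∧ wₙ)`. -/
def corestriction (𝒲 : ℤ → Submodule K W) (θ : CExt 𝒲 →ₗ[K] CExt 𝒲) (n : ℕ+) :
    MultilinearMap K (fun _ : Fin n => W) W :=
  (proj 𝒲 ∘ₗ θ).compMultilinearMap (wedge 𝒲 n)

end coalgebra

/-! ### Desuspension and `L∞`-algebras -/

section linf

variable {K : Type*} [Field K] {V : Type*} [AddCommGroup V] [Module K V]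

/-- The grading of the desuspension: `(↓V)^p = V^{p+1}`. The underlying vector space of `↓V` is that
of `V`, and `↓ : V → ↓V` is the identity map, which has degree `-1` for these gradings. -/
def desusp (𝒱 : ℤ → Submodule K V) : ℤ → Submodule K V := fun p => 𝒱 (p + 1)

instance desuspDecomposition (𝒱 : ℤ → Submodule K V) [DirectSum.Decomposition 𝒱] :
    DirectSum.Decomposition (desusp 𝒱) :=
  DirectSum.IsInternal.chooseDecomposition _ (by
    have h := (DirectSum.isInternal_submodule_iff_iSupIndep_and_iSup_eq_top 𝒱).mp
      (DirectSum.Decomposition.isInternal 𝒱)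
    refine (DirectSum.isInternal_submodule_iff_iSupIndep_and_iSup_eq_top _).mpr ⟨?_, ?_⟩
    · exact h.1.comp (f := fun p : ℤ => p + 1) (add_left_injective 1)
    · rw [← h.2]
      exact (Equiv.addRight (1 : ℤ)).iSup_comp (g := 𝒱))

/-- The sign in `↓^{⊗n} (v₁ ⊗ ⋯ ⊗ vₙ) = ± ↓v₁ ⊗ ⋯ ⊗ ↓vₙ` for `vᵢ` of degree `dᵢ`: by the Koszul
sign convention, `vᵢ` is passed by the `n - i` degree `-1` maps `↓` to the right of the `i`-th one,
so the sign is `∏ᵢ (-1)^{(n-i) dᵢ}` for `i = 1, …, n` (below, `i` is written as `i + 1`). -/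
def desuspSign {n : ℕ} (d : Fin n → ℤ) : ℤˣ :=
  ∏ i : Fin n, (((n : ℤ) - ((i : ℤ) + 1)) * d i).negOnePow

/-- An `L∞`-algebra structure on the graded vector space `V`: the linear maps `l k : V^{⊗k} → V`,
`k ≥ 1`, are given as multilinear maps. In the axiom `(L_n)` the number `i` of the inputs
of the inner operation is written as `i + 1`, so that `j = n - i`, i.e. `j = (n - (i + 1)) + 1`. -/
@[ext]
structure LInfStructure (𝒱 : ℤ → Submodule K V) where
  l : ∀ k : ℕ+, MultilinearMap K (fun _ : Fin k => V) V
  degree : ∀ (k : ℕ+) (d : Fin k → ℤ) (v : Fin k → V), (∀ a, v a ∈ 𝒱 (d a)) →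
    l k v ∈ 𝒱 (∑ a, d a + (2 - (k : ℤ)))
  antisymm : ∀ (k : ℕ+) (d : Fin k → ℤ) (v : Fin k → V), (∀ a, v a ∈ 𝒱 (d a)) →
    ∀ σ : Equiv.Perm (Fin k), l k (v ∘ σ) = antiKoszul σ d • l k v
  jacobi : ∀ (n : ℕ) (_ : 1 ≤ n) (d : Fin n → ℤ) (v : Fin n → V), (∀ a, v a ∈ 𝒱 (d a)) →
    ∑ i : Fin n, (-1 : ℤˣ) ^ ((i : ℕ) + 1) •
      ∑ σ ∈ unshuffles (i + 1) n i.2, antiKoszul σ d •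
        l (Nat.succPNat (n - (i + 1)))
          (Fin.cons (α := fun _ => V)
            (l (Nat.succPNat i) fun a => v (σ (split (i + 1) n i.2 (Sum.inl a))))
            fun b => v (σ (split (i + 1) n i.2 (Sum.inr b)))) = 0

end linf

end LInfty

end

/-!
The Koszul-signed sum over all splittings of a list of homogeneous elements into two
complementary sublists is coassociative and graded cocommutative. Hence every linear map `φ :
ᶜ∧(W) → W` extends to a coderivation, `∑ φ(w_{σ 1} ∧ ⋯ ∧ w_{σ i}) ∧ w_{σ (i + 1)} ∧ ⋯ ∧ w_{σ n}`.
In characteristic zero it is the only coderivation with corestriction `φ`: the extension of the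
projection to `W` is the Euler operator, which is invertible as it multiplies `∧ⁿ W` by `n`, so
that no element outside `W` is primitive, and by induction on `n` a coderivation without
corestriction vanishes. The square of an odd coderivation is again a coderivation, so it vanishes
as soon as its corestriction does, and this is the Jacobi identity without the signs of the
suspended convention. Conjugation by `↓ ⊗ ⋯ ⊗ ↓`, with the sign `(-1)^{n(n+1)/2}`, turns Koszul
signs into antisymmetric Koszul signs and introduces the signs `(-1)^i` of the Jacobi identity of
an `L∞`-algebra.
-/

noncomputable section

open scoped TensorProduct DirectSum

namespace LInfty

/-! ### Signed sums over the splittings of a list -/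

section splittings

variable {H : Type*} (δ : H → ℤ) {M : Type*} [AddCommGroup M]

/-- The total degree of a list of elements with degree function `δ`. -/
def listDeg (l : List H) : ℤ := (l.map δ).sum

@[simp] lemma listDeg_nil : listDeg δ [] = 0 := rfl

@[simp] lemma listDeg_cons (x : H) (l : List H) : listDeg δ (x :: l) = δ x + listDeg δ l := by
  simp [listDeg]

/-- The sum of `G A B` over all splittings of a list into two complementary sublists `A`, `B`, with
the Koszul sign of the permutation that moves `A` in front of `B`. It encodes the sum over all
unshuffles of all types, and unlike the latter it is amenable to induction. -/
def splitSum : List H → (List H → List H → M) → M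
  | [], G => G [] []
  | x :: l, G =>
    splitSum l fun A B => G (x :: A) B + (δ x * listDeg δ A).negOnePow • G A (x :: B)

lemma splitSum_congr (l : List H) (F G : List H → List H → M)
    (h : ∀ A B, listDeg δ A + listDeg δ B = listDeg δ l → A.length + B.length = l.length →
      F A B = G A B) : splitSum δ l F = splitSum δ l G := by
  induction l generalizing F G with
  | nil => exact h [] [] rfl rfl
  | cons x l ih =>
    refine ih _ _ fun A B hdeg hlen => ?_
    rw [h (x :: A) B (by simp [add_assoc, hdeg]) (by simp; omega),
      h A (x :: B) (by simp; omega) (by simp; omega)]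

lemma splitSum_mem (S : AddSubgroup M) (l : List H) (F : List H → List H → M)
    (h : ∀ A B, listDeg δ A + listDeg δ B = listDeg δ l → F A B ∈ S) :
    splitSum δ l F ∈ S := by
  induction l generalizing F with
  | nil => exact h [] [] rfl
  | cons x l ih =>
    refine ih _ fun A B hdeg => S.add_mem (h _ _ (by simp [add_assoc, hdeg])) ?_
    rw [Units.smul_def]
    exact S.zsmul_mem (h _ _ (by simp; omega)) _

lemma splitSum_zero (l : List H) : splitSum δ l (fun _ _ => (0 : M)) = 0 := by
  induction l with
  | nil => rfl
  | cons x l ih => simpa [splitSum] using ih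

lemma splitSum_add (l : List H) (F G : List H → List H → M) :
    splitSum δ l (fun A B => F A B + G A B) = splitSum δ l F + splitSum δ l G := by
  induction l generalizing F G with
  | nil => rfl
  | cons x l ih =>
    simp only [splitSum, ← ih, smul_add]
    exact splitSum_congr δ l _ _ fun A B _ _ => add_add_add_comm ..

lemma splitSum_sum {ι : Type*} (s : Finset ι) (l : List H) (F : ι → List H → List H → M) :
    splitSum δ l (fun A B => ∑ i ∈ s, F i A B) = ∑ i ∈ s, splitSum δ l (F i) := by
  induction s using Finset.cons_induction with
  | empty => simp [splitSum_zero]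
  | cons i s hi ih => simp only [Finset.sum_cons, splitSum_add, ih]

lemma map_units_smul {A B F : Type*} [AddCommGroup A] [AddCommGroup B] [FunLike F A B]
    [AddMonoidHomClass F A B] (f : F) (s : ℤˣ) (a : A) : f (s • a) = s • f a := by
  rw [Units.smul_def, map_zsmul, Units.smul_def]

lemma map_splitSum {M' F : Type*} [AddCommGroup M'] [FunLike F M M'] [AddMonoidHomClass F M M']
    (f : F) (l : List H) (G : List H → List H → M) :
    f (splitSum δ l G) = splitSum δ l fun A B => f (G A B) := by
  induction l generalizing G with
  | nil => rfl
  | cons x l ih => simp only [splitSum, ih, map_add, map_units_smul]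

lemma smul_splitSum (s : ℤˣ) (l : List H) (F : List H → List H → M) :
    s • splitSum δ l F = splitSum δ l fun A B => s • F A B :=
  map_splitSum δ (DistribSMul.toAddMonoidHom M s) l F

lemma splitSum_assoc (l : List H) (F : List H → List H → List H → M) :
    splitSum δ l (fun A B => splitSum δ B fun C D => F A C D) =
      splitSum δ l fun E D => splitSum δ E fun A C => F A C D := by
  induction l generalizing F with
  | nil => rfl
  | cons x l ih =>
    simp only [splitSum]
    rw [splitSum_add, splitSum_add]
    simp only [smul_splitSum]
    rw [ih, ih, ← splitSum_add, ← splitSum_add]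
    refine splitSum_congr δ l _ _ fun E D _ _ => ?_
    rw [← splitSum_add, ← splitSum_add]
    refine splitSum_congr δ E _ _ fun A C hdeg _ => ?_
    rw [smul_add, smul_smul, ← hdeg, mul_add, Int.negOnePow_add, add_assoc]

lemma splitSum_comm (l : List H) (F : List H → List H → M) :
    splitSum δ l F =
      splitSum δ l fun A B => (listDeg δ A * listDeg δ B).negOnePow • F B A := by
  induction l generalizing F with
  | nil => simp [splitSum]
  | cons x l ih =>
    simp only [splitSum]
    rw [ih]
    refine splitSum_congr δ l _ _ fun A B _ _ => ?_
    rw [smul_add, add_comm, smul_smul, smul_smul, ← Int.negOnePow_add, ← Int.negOnePow_add,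
      listDeg_cons, listDeg_cons]
    congr 2
    · congr 1
      ring
    · rw [Int.negOnePow_eq_iff]
      exact ⟨-(listDeg δ A * δ x), by ring⟩

lemma splitSum_of_left_ne_nil (l : List H) (F : List H → List H → M)
    (h : ∀ A B, A ≠ [] → F A B = 0) : splitSum δ l F = F [] l := by
  induction l generalizing F with
  | nil => rfl
  | cons x l ih =>
    rw [splitSum, ih _ fun A B hA => by simp [h (x :: A) B (by simp), h A (x :: B) hA]]
    simp [h [x] l (by simp)]

lemma splitSum_of_right_ne_nil (l : List H) (F : List H → List H → M)
    (h : ∀ A B, B ≠ [] → F A B = 0) : splitSum δ l F = F l [] := by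
  rw [splitSum_comm, splitSum_of_left_ne_nil δ l _ fun A B hA => by rw [h B A hA, smul_zero]]
  simp

end splittings

/-! ### Sums over unshuffles as sums over splittings -/

section unshuffleSums

lemma mem_unshuffles_iff {i n : ℕ} (h : i ≤ n) (σ : Equiv.Perm (Fin n)) :
    σ ∈ unshuffles i n h ↔
      ∀ a b : Fin n, a < b → (b.val < i ∨ i ≤ a.val) → σ a < σ b := by
  simp only [unshuffles, Finset.mem_filter, Finset.mem_univ, true_and]
  refine ⟨fun ⟨hleft, hright⟩ a b hab hi => ?_, fun hσ =>
    ⟨fun a b hab => hσ _ _ ?_ (Or.inl ?_), fun a b hab => hσ _ _ ?_ (Or.inr ?_)⟩⟩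
  · obtain ⟨a | a, rfl⟩ := (split i n h).surjective a <;>
      obtain ⟨b | b, rfl⟩ := (split i n h).surjective b <;>
      simp only [Fin.lt_def, split_inl_val, split_inr_val] at hab hi
    · exact hleft a b hab
    · omega
    · omega
    · exact hright a b (by simpa using hab)
  all_goals simp only [Fin.lt_def, split_inl_val, split_inr_val]; omega

/-- The permutation of `Fin (n + 1)` that fixes `0` and acts by `π` on the successors. -/
def consPerm {n : ℕ} (π : Equiv.Perm (Fin n)) : Equiv.Perm (Fin (n + 1)) :=
  Equiv.Perm.decomposeFin.symm (0, π)

@[simp] lemma consPerm_zero {n : ℕ} (π : Equiv.Perm (Fin n)) : consPerm π 0 = 0 := by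
  simp [consPerm]

@[simp] lemma consPerm_succ {n : ℕ} (π : Equiv.Perm (Fin n)) (a : Fin n) :
    consPerm π a.succ = (π a).succ := by
  simp [consPerm]

lemma consPerm_injective {n : ℕ} : Function.Injective (consPerm (n := n)) := fun _ _ h =>
  (Prod.ext_iff.mp (Equiv.Perm.decomposeFin.symm.injective h)).2

lemma exists_consPerm_eq {n : ℕ} (σ : Equiv.Perm (Fin (n + 1))) (h : σ 0 = 0) :
    ∃ π, consPerm π = σ := by
  obtain ⟨⟨p, π⟩, rfl⟩ := Equiv.Perm.decomposeFin.symm.surjective σ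
  obtain rfl : p = 0 := by simpa using h
  exact ⟨π, rfl⟩

lemma cons_comp_consPerm {n : ℕ} {α : Type*} (x : α) (u : Fin n → α) (π : Equiv.Perm (Fin n)) :
    (Fin.cons x u : Fin (n + 1) → α) ∘ consPerm π = Fin.cons x (u ∘ π) := by
  funext a
  cases a using Fin.cases <;> simp

lemma koszul_consPerm {n : ℕ} (π : Equiv.Perm (Fin n)) (x : ℤ) (u : Fin n → ℤ) :
    koszul (consPerm π) (Fin.cons x u) = koszul π u := by
  simp [koszul, Fin.prod_univ_succ]

lemma negOnePow_sum {ι : Type*} (s : Finset ι) (f : ι → ℤ) :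
    (∑ i ∈ s, f i).negOnePow = ∏ i ∈ s, (f i).negOnePow := by
  induction s using Finset.cons_induction with
  | empty => simp
  | cons a s ha ih => rw [Finset.sum_cons, Finset.prod_cons, Int.negOnePow_add, ih]

lemma cycleRange_inversion_iff {n : ℕ} (p a b : Fin (n + 1)) :
    (a < b ∧ p.cycleRange b < p.cycleRange a) ↔ a < p ∧ b = p := by
  revert a b
  simp only [Fin.forall_iff_succAbove p, Fin.cycleRange_self, Fin.cycleRange_succAbove,
    (Fin.strictMono_succAbove p).lt_iff_lt, Fin.succ_lt_succ_iff]
  simpa using fun _ _ => le_of_lt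

lemma koszul_cycleRange {n : ℕ} (p : Fin (n + 1)) (x : ℤ) (u : Fin n → ℤ) :
    koszul p.cycleRange (Fin.cons x u) =
      (x * ((List.ofFn u).take p).sum).negOnePow := by
  simp only [koszul, cycleRange_inversion_iff, ite_and, Finset.prod_ite_irrel,
    Finset.prod_ite_eq', Finset.mem_univ, if_true, Finset.prod_const_one]
  rw [Fin.prod_univ_succAbove _ p, List.sum_take_ofFn, Finset.mul_sum, negOnePow_sum,
    Finset.prod_filter]
  simp only [lt_irrefl, if_false, one_mul, Fin.cycleRange_self, Fin.cycleRange_succAbove,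
    Fin.cons_zero, Fin.cons_succ, Fin.succAbove_lt_iff_castSucc_lt, mul_comm]
  rfl

/-- The permutation of `Fin (n + 1)` with value `0` at `i` and the successors of the values of `π`,
in order, at the remaining positions. -/
def insertPerm {n i : ℕ} (hi : i ≤ n) (π : Equiv.Perm (Fin n)) : Equiv.Perm (Fin (n + 1)) :=
  consPerm π * Fin.cycleRange ⟨i, Nat.lt_succ_of_le hi⟩

lemma insertPerm_injective {n i : ℕ} (hi : i ≤ n) : Function.Injective (insertPerm hi) :=
  fun _ _ h => consPerm_injective (mul_right_cancel h)

lemma insertPerm_apply_self {n i : ℕ} (hi : i ≤ n) (π : Equiv.Perm (Fin n)) :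
    insertPerm hi π ⟨i, Nat.lt_succ_of_le hi⟩ = 0 := by
  simp [insertPerm]

lemma exists_insertPerm_eq {n i : ℕ} (hi : i ≤ n) (σ : Equiv.Perm (Fin (n + 1)))
    (h : σ ⟨i, Nat.lt_succ_of_le hi⟩ = 0) : ∃ π, insertPerm hi π = σ := by
  obtain ⟨π, hπ⟩ := exists_consPerm_eq (σ * (Fin.cycleRange ⟨i, Nat.lt_succ_of_le hi⟩)⁻¹) (by
    rw [Equiv.Perm.mul_apply, Equiv.Perm.inv_def, Fin.cycleRange_symm_zero, h])
  exact ⟨π, eq_mul_inv_iff_mul_eq.mp hπ⟩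

lemma cons_comp_insertPerm {n i : ℕ} {α : Type*} (hi : i ≤ n) (x : α) (u : Fin n → α)
    (π : Equiv.Perm (Fin n)) :
    (Fin.cons x u : Fin (n + 1) → α) ∘ insertPerm hi π =
      Fin.insertNth (α := fun _ => α) ⟨i, Nat.lt_succ_of_le hi⟩ x (u ∘ π) := by
  rw [insertPerm, Equiv.Perm.coe_mul, ← Function.comp_assoc, cons_comp_consPerm,
    Fin.cons_comp_cycleRange]

lemma koszul_insertPerm {n i : ℕ} (hi : i ≤ n) (π : Equiv.Perm (Fin n)) (x : ℤ) (u : Fin n → ℤ) :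
    koszul (insertPerm hi π) (Fin.cons x u) =
      koszul π u * (x * ((List.ofFn (u ∘ π)).take i).sum).negOnePow := by
  rw [insertPerm, koszul_mul, koszul_consPerm, cons_comp_consPerm, koszul_cycleRange]

lemma ofFn_insertNth {n : ℕ} {α : Type*} (p : Fin (n + 1)) (x : α) (u : Fin n → α) :
    List.ofFn (p.insertNth x u : Fin (n + 1) → α) =
      (List.ofFn u).take p ++ x :: (List.ofFn u).drop p := by
  induction n with
  | zero =>
    obtain rfl : p = 0 := Fin.fin_one_eq_zero p
    simp
  | succ n ih =>
    cases p using Fin.cases with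
    | zero => simp
    | succ p =>
      have : (p.succ.insertNth x u : Fin (n + 1 + 1) → α)
          = Fin.cons (u 0) (p.insertNth x (fun a => u a.succ)) := by
        refine Fin.insertNth_eq_iff.mpr ⟨by simp, funext fun a => ?_⟩
        cases a using Fin.cases <;> simp [Fin.removeNth]
      rw [this, List.ofFn_cons, ih, List.ofFn_succ (f := u)]
      simp

lemma take_ofFn_eq_ofFn_split {α : Type*} {i n : ℕ} (h : i ≤ n) (w : Fin n → α) :
    (List.ofFn w).take i = List.ofFn fun a => w (split i n h (Sum.inl a)) := by
  refine List.ext_getElem (by simpa using h) fun k _ _ => ?_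
  simp only [List.getElem_take, List.getElem_ofFn]
  exact congrArg w (Fin.ext (by simp [split_inl_val]))

lemma drop_ofFn_eq_ofFn_split {α : Type*} {i n : ℕ} (h : i ≤ n) (w : Fin n → α) :
    (List.ofFn w).drop i = List.ofFn fun a => w (split i n h (Sum.inr a)) := by
  refine List.ext_getElem (by simp) fun k _ _ => ?_
  simp only [List.getElem_drop, List.getElem_ofFn]
  exact congrArg w (Fin.ext (by simp [split_inr_val]))

lemma unshuffle_apply_eq_zero {i n : ℕ} (hi : i ≤ n + 1) {σ : Equiv.Perm (Fin (n + 1))}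
    (hσ : σ ∈ unshuffles i (n + 1) hi) :
    (0 < i ∧ σ 0 = 0) ∨ ∃ h : i < n + 1, σ ⟨i, h⟩ = 0 := by
  rw [mem_unshuffles_iff] at hσ
  obtain ⟨q, hq⟩ := σ.surjective 0
  have eq_of_le (p : Fin (n + 1)) (hp : p ≤ q) (h : q.val < i ∨ i ≤ p.val) : p = q :=
    hp.eq_of_not_lt fun hlt => absurd (hq ▸ hσ p q hlt h) (Fin.not_lt_zero _)
  rcases lt_or_ge q.val i with h | h
  · exact Or.inl ⟨by omega, eq_of_le 0 (Fin.zero_le q) (Or.inl h) ▸ hq⟩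
  · exact Or.inr ⟨by omega, eq_of_le ⟨i, by omega⟩ h (Or.inr le_rfl) ▸ hq⟩

lemma consPerm_mem_unshuffles {i n : ℕ} (hi : i ≤ n) (π : Equiv.Perm (Fin n)) :
    consPerm π ∈ unshuffles (i + 1) (n + 1) (by omega) ↔ π ∈ unshuffles i n hi := by
  simp [mem_unshuffles_iff, Fin.forall_fin_succ]

lemma insertPerm_mem_unshuffles {i n : ℕ} (hi : i ≤ n) (π : Equiv.Perm (Fin n)) :
    insertPerm hi π ∈ unshuffles i (n + 1) (by omega) ↔ π ∈ unshuffles i n hi := by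
  simp only [mem_unshuffles_iff, insertPerm, Equiv.Perm.mul_apply]
  set p : Fin (n + 1) := ⟨i, Nat.lt_succ_of_le hi⟩ with hp
  have val_succAbove (a : Fin n) :
      (p.succAbove a).val = if a.val < i then a.val else a.val + 1 := by
    simp only [Fin.succAbove, Fin.lt_def, hp, Fin.val_castSucc]
    split_ifs <;> simp
  simp only [Fin.forall_iff_succAbove p,
    Fin.cycleRange_self, Fin.cycleRange_succAbove, consPerm_zero, consPerm_succ,
    (Fin.strictMono_succAbove p).lt_iff_lt, Fin.succ_lt_succ_iff, Fin.succ_pos]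
  refine ⟨fun hσ a b hab h => (hσ.2 a).2 b hab ?_, fun hπ =>
    ⟨⟨fun h => absurd h (lt_irrefl _), fun _ _ _ => trivial⟩, fun a =>
      ⟨fun hap h => ?_, fun b hab h => hπ a b hab ?_⟩⟩⟩
  all_goals grind [Fin.lt_def]

lemma sum_unshuffles_filter_zero {n i : ℕ} {M : Type*} [AddCommMonoid M] (hi : i ≤ n)
    (F : Equiv.Perm (Fin (n + 1)) → M) :
    ∑ σ ∈ unshuffles (i + 1) (n + 1) (by omega) with σ 0 = 0, F σ =
      ∑ π ∈ unshuffles i n hi, F (consPerm π) := by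
  symm
  refine Finset.sum_bij (fun π _ => consPerm π) (fun π hπ => ?_)
    (fun _ _ _ _ h => consPerm_injective h) (fun σ hσ => ?_) fun _ _ => rfl
  · simpa using (consPerm_mem_unshuffles hi π).mpr hπ
  · obtain ⟨hmem, hzero⟩ := Finset.mem_filter.mp hσ
    obtain ⟨π, rfl⟩ := exists_consPerm_eq σ hzero
    exact ⟨π, (consPerm_mem_unshuffles hi π).mp hmem, rfl⟩

lemma sum_unshuffles_filter_apply {n i : ℕ} {M : Type*} [AddCommMonoid M] (hi : i ≤ n)
    (F : Equiv.Perm (Fin (n + 1)) → M) :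
    ∑ σ ∈ unshuffles i (n + 1) (by omega) with σ ⟨i, by omega⟩ = 0, F σ =
      ∑ π ∈ unshuffles i n hi, F (insertPerm hi π) := by
  symm
  refine Finset.sum_bij (fun π _ => insertPerm hi π) (fun π hπ => ?_)
    (fun _ _ _ _ h => insertPerm_injective hi h) (fun σ hσ => ?_) fun _ _ => rfl
  · exact Finset.mem_filter.mpr
      ⟨(insertPerm_mem_unshuffles hi π).mpr hπ, insertPerm_apply_self hi π⟩
  · obtain ⟨hmem, hzero⟩ := Finset.mem_filter.mp hσ
    obtain ⟨π, rfl⟩ := exists_insertPerm_eq hi σ hzero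
    exact ⟨π, (insertPerm_mem_unshuffles hi π).mp hmem, rfl⟩

lemma sum_unshuffles_zero_succ {n : ℕ} {M : Type*} [AddCommMonoid M]
    (F : Equiv.Perm (Fin (n + 1)) → M) :
    ∑ σ ∈ unshuffles 0 (n + 1) (Nat.zero_le _), F σ =
      ∑ π ∈ unshuffles 0 n (Nat.zero_le _), F (insertPerm (Nat.zero_le n) π) := by
  rw [← sum_unshuffles_filter_apply, Finset.filter_true_of_mem]
  intro σ hσ
  simpa using unshuffle_apply_eq_zero _ hσ

lemma sum_unshuffles_succ_self {n : ℕ} {M : Type*} [AddCommMonoid M]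
    (F : Equiv.Perm (Fin (n + 1)) → M) :
    ∑ σ ∈ unshuffles (n + 1) (n + 1) le_rfl, F σ =
      ∑ π ∈ unshuffles n n le_rfl, F (consPerm π) := by
  rw [← sum_unshuffles_filter_zero, Finset.filter_true_of_mem]
  intro σ hσ
  simpa using unshuffle_apply_eq_zero _ hσ

lemma sum_unshuffles_succ_succ {n i : ℕ} {M : Type*} [AddCommMonoid M] (hi : i + 1 ≤ n)
    (F : Equiv.Perm (Fin (n + 1)) → M) :
    ∑ σ ∈ unshuffles (i + 1) (n + 1) (by omega), F σ =
      ∑ π ∈ unshuffles i n (by omega), F (consPerm π) +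
        ∑ π ∈ unshuffles (i + 1) n hi, F (insertPerm hi π) := by
  rw [← Finset.sum_filter_add_sum_filter_not _ (fun σ => σ 0 = 0),
    sum_unshuffles_filter_zero (by omega : i ≤ n), ← sum_unshuffles_filter_apply hi]
  refine congrArg _ (Finset.sum_congr (Finset.filter_congr fun σ hσ => ?_) fun _ _ => rfl)
  constructor
  · intro hne
    obtain ⟨-, h⟩ | ⟨_, h⟩ := unshuffle_apply_eq_zero _ hσ
    exacts [absurd h hne, h]
  · intro h hzero
    simpa using σ.injective (h.trans hzero.symm)

variable {H : Type*} (δ : H → ℤ) {M : Type*} [AddCommGroup M]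

/-- The sum over the `(i, n - i)`-unshuffles `σ` of `G A B` with its Koszul sign, where `A` and `B`
list the elements of `h` with indices `σ 1, …, σ i` and `σ (i + 1), …, σ n`. -/
def unshuffleSum {n : ℕ} (h : Fin n → H) (G : List H → List H → M) (i : ℕ) (hi : i ≤ n) : M :=
  ∑ σ ∈ unshuffles i n hi, koszul σ (δ ∘ h) •
    G (List.ofFn fun a => h (σ (split i n hi (Sum.inl a))))
      (List.ofFn fun b => h (σ (split i n hi (Sum.inr b))))

lemma unshuffleSum_eq_sum_take_drop {n i : ℕ} (h : Fin n → H) (G : List H → List H → M)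
    (hi : i ≤ n) :
    unshuffleSum δ h G i hi = ∑ σ ∈ unshuffles i n hi, koszul σ (δ ∘ h) •
      G ((List.ofFn (h ∘ σ)).take i) ((List.ofFn (h ∘ σ)).drop i) := by
  simp only [take_ofFn_eq_ofFn_split hi, drop_ofFn_eq_ofFn_split hi]
  rfl

lemma sum_unshuffles_consPerm {n i : ℕ} (hi : i ≤ n) (x : H) (g : Fin n → H)
    (G : List H → List H → M) :
    ∑ π ∈ unshuffles i n hi, koszul (consPerm π) (δ ∘ (Fin.cons x g : Fin (n + 1) → H)) •
      G ((List.ofFn ((Fin.cons x g : Fin (n + 1) → H) ∘ consPerm π)).take (i + 1))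
        ((List.ofFn ((Fin.cons x g : Fin (n + 1) → H) ∘ consPerm π)).drop (i + 1)) =
      unshuffleSum δ g (fun A B => G (x :: A) B) i hi := by
  rw [unshuffleSum_eq_sum_take_drop]
  refine Finset.sum_congr rfl fun π _ => ?_
  rw [Fin.comp_cons, koszul_consPerm, cons_comp_consPerm, List.ofFn_cons, List.take_succ_cons,
    List.drop_succ_cons]

lemma sum_unshuffles_insertPerm {n i : ℕ} (hi : i ≤ n) (x : H) (g : Fin n → H)
    (G : List H → List H → M) :
    ∑ π ∈ unshuffles i n hi, koszul (insertPerm hi π) (δ ∘ (Fin.cons x g : Fin (n + 1) → H)) •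
      G ((List.ofFn ((Fin.cons x g : Fin (n + 1) → H) ∘ insertPerm hi π)).take i)
        ((List.ofFn ((Fin.cons x g : Fin (n + 1) → H) ∘ insertPerm hi π)).drop i) =
      unshuffleSum δ g (fun A B => (δ x * listDeg δ A).negOnePow • G A (x :: B)) i hi := by
  rw [unshuffleSum_eq_sum_take_drop]
  refine Finset.sum_congr rfl fun π _ => ?_
  have length_take : ((List.ofFn (g ∘ π)).take i).length = i := by simpa using hi
  rw [cons_comp_insertPerm, ofFn_insertNth, List.take_left' length_take,
    List.drop_left' length_take, Fin.comp_cons, koszul_insertPerm, mul_smul, listDeg,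
    List.map_take, List.map_ofFn, Function.comp_assoc]

theorem unshuffleSum_eq_splitSum {n i : ℕ} (hi : i ≤ n) (h : Fin n → H)
    (G : List H → List H → M) :
    unshuffleSum δ h G i hi =
      splitSum δ (List.ofFn h) fun A B => if A.length = i then G A B else 0 := by
  induction n generalizing i G with
  | zero =>
    obtain rfl : i = 0 := by omega
    have : unshuffles 0 0 le_rfl = {1} := by
      ext σ
      simp [mem_unshuffles_iff, Subsingleton.elim σ 1]
    simp [unshuffleSum, splitSum, this, koszul_one]
  | succ n ih =>
    obtain ⟨x, g, rfl⟩ : ∃ x g, h = (Fin.cons x g : Fin (n + 1) → H) :=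
      ⟨h 0, Fin.tail h, (Fin.cons_self_tail h).symm⟩
    rw [List.ofFn_cons, splitSum, splitSum_add, unshuffleSum_eq_sum_take_drop]
    rcases i with _ | i
    · rw [sum_unshuffles_zero_succ, sum_unshuffles_insertPerm, ih]
      simp [splitSum_zero, smul_ite]
    · obtain hi' | rfl : i + 1 ≤ n ∨ i = n := by omega
      · rw [sum_unshuffles_succ_succ hi', sum_unshuffles_consPerm,
          sum_unshuffles_insertPerm, ih, ih]
        simp [smul_ite]
      · rw [sum_unshuffles_succ_self, sum_unshuffles_consPerm, ih,
          splitSum_congr δ (List.ofFn g) (fun A B => _ • ite _ _ _) (fun _ _ => 0), splitSum_zero]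
        · simp
        · intro A B _ hlen
          rw [List.length_ofFn] at hlen
          rw [if_neg (by omega), smul_zero]

lemma sum_unshuffleSum_eq_splitSum {n : ℕ} (h : Fin n → H) (G : List H → List H → M)
    (hG : ∀ B, G [] B = 0) :
    ∑ i : Fin n, unshuffleSum δ h G (i + 1) i.2 = splitSum δ (List.ofFn h) G := by
  simp only [unshuffleSum_eq_splitSum]
  rw [← splitSum_sum]
  refine splitSum_congr δ _ _ _ fun A B _ hlen => ?_
  rw [List.length_ofFn] at hlen
  rcases A with _ | ⟨x, A⟩
  · simp [hG]
  · rw [Finset.sum_eq_single ⟨A.length, by grind⟩] <;> grind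

end unshuffleSums

/-! ### Maps determined on homogeneous elements -/

section homogeneousExt

variable {R M N ι κ : Type*} [CommSemiring R] [AddCommMonoid M] [Module R M] [AddCommMonoid N]
  [Module R N] [DecidableEq ι] (ℳ : ι → Submodule R M) [DirectSum.Decomposition ℳ]

lemma linearMap_ext_homogeneous {f g : M →ₗ[R] N} (h : ∀ p, ∀ x ∈ ℳ p, f x = g x) : f = g := by
  ext x
  induction x using DirectSum.Decomposition.inductionOn ℳ with
  | zero => simp
  | homogeneous x => exact h _ _ x.2
  | add x y hx hy => rw [map_add, map_add, hx, hy]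

lemma multilinearMap_ext_homogeneous [Finite κ] {f g : MultilinearMap R (fun _ : κ => M) N}
    (h : ∀ (d : κ → ι) (x : κ → M), (∀ i, x i ∈ ℳ (d i)) → f x = g x) : f = g := by
  let e := (DirectSum.decomposeLinearEquiv ℳ).symm.toLinearMap
  have agree : f.compLinearMap (fun _ => e) = g.compLinearMap fun _ => e := by
    refine MultilinearMap.directSum_ext fun d => MultilinearMap.ext fun x => ?_
    simpa [e] using h d (fun i => x i) fun i => (x i).2
  ext x
  simpa only [e, MultilinearMap.compLinearMap_apply, LinearEquiv.coe_coe,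
    DirectSum.decomposeLinearEquiv_symm_apply, Equiv.symm_apply_apply] using
    congrArg (fun φ => φ fun i => DirectSum.decompose ℳ (x i)) agree

end homogeneousExt

/-! ### Products of lists of homogeneous elements -/

section wedgeList

variable {K : Type*} [Field K] {W : Type*} [AddCommGroup W] [Module K W]
variable {N : Type*} [AddCommGroup N] [Module K N] {𝒲 : ℤ → Submodule K W}

/-- The homogeneous elements of a graded vector space, together with their degrees. -/
abbrev Homog (𝒲 : ℤ → Submodule K W) : Type _ := Σ p : ℤ, 𝒲 p

/-- The product `x₁ ∧ ⋯ ∧ xₙ` of a list of homogeneous elements. Since `ᶜ∧(W)` has no `∧⁰ W`, the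
value at the empty list is `0`. -/
def wedgeList : List (Homog 𝒲) → CExt 𝒲
  | [] => 0
  | x :: l => wedge 𝒲 (Nat.succPNat l.length) fun a => ((x :: l).get a).2

@[simp] lemma wedgeList_nil : wedgeList ([] : List (Homog 𝒲)) = 0 := rfl

lemma wedgeList_eq_wedge (n : ℕ+) (l : List (Homog 𝒲)) (hl : (n : ℕ) = l.length) :
    wedgeList l = wedge 𝒲 n fun a => ((l.get (a.cast hl)).2 : W) := by
  match l, hl with
  | [], hl => exact absurd hl n.ne_zero
  | x :: l, hl =>
    obtain rfl : n = Nat.succPNat l.length := PNat.eq hl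
    rfl

lemma wedgeList_ofFn (n : ℕ+) (u : Fin n → Homog 𝒲) :
    wedgeList (List.ofFn u) = wedge 𝒲 n fun a => ((u a).2 : W) := by
  rw [wedgeList_eq_wedge n _ List.length_ofFn.symm]
  congr 1
  funext a
  exact congrArg (fun z : Homog 𝒲 => (z.2 : W)) (List.get_ofFn u _)

lemma exists_homog {n : ℕ} (d : Fin n → ℤ) (w : Fin n → W) (hw : ∀ i, w i ∈ 𝒲 (d i)) :
    ∃ u : Fin n → Homog 𝒲, d = Sigma.fst ∘ u ∧ w = fun a => ((u a).2 : W) :=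
  ⟨fun i => ⟨d i, w i, hw i⟩, rfl, rfl⟩

lemma listDeg_ofFn {H : Type*} (δ : H → ℤ) {n : ℕ} (u : Fin n → H) :
    listDeg δ (List.ofFn u) = ∑ a, δ (u a) := by
  simp [listDeg, List.map_ofFn, List.sum_ofFn]

lemma exists_ofFn_eq {α : Type*} (l : List α) (hl : l ≠ []) :
    ∃ (n : ℕ+) (u : Fin n → α), l = List.ofFn u :=
  ⟨⟨l.length, List.length_pos_of_ne_nil hl⟩, l.get, (List.ofFn_get l).symm⟩

lemma wedgeList_mem (l : List (Homog 𝒲)) : wedgeList l ∈ extDeg 𝒲 (listDeg Sigma.fst l) := by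
  rcases eq_or_ne l [] with rfl | hl
  · exact zero_mem _
  · obtain ⟨n, u, rfl⟩ := exists_ofFn_eq l hl
    rw [wedgeList_ofFn, listDeg_ofFn]
    exact Submodule.subset_span ⟨n, _, _, fun i => (u i).2.2, rfl, rfl⟩

lemma extDeg_le_iff {p : ℤ} {S : Submodule K (CExt 𝒲)} :
    extDeg 𝒲 p ≤ S ↔ ∀ l : List (Homog 𝒲), listDeg Sigma.fst l = p → wedgeList l ∈ S := by
  refine ⟨fun h l hl => h (hl ▸ wedgeList_mem l), fun h => Submodule.span_le.mpr ?_⟩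
  rintro _ ⟨n, d, w, hw, rfl, rfl⟩
  obtain ⟨u, rfl, rfl⟩ := exists_homog d w hw
  rw [← wedgeList_ofFn]
  exact h _ (listDeg_ofFn _ u)

lemma wedgeList_eq_koszul_smul {n : ℕ} (u : Fin n → Homog 𝒲) (σ : Equiv.Perm (Fin n)) :
    wedgeList (List.ofFn u) = koszul σ (Sigma.fst ∘ u) • wedgeList (List.ofFn (u ∘ σ)) := by
  rcases n.eq_zero_or_pos with rfl | hn
  · simp
  · lift n to ℕ+ using hn
    rw [wedgeList_ofFn, wedgeList_ofFn]
    exact wedge_perm 𝒲 n _ _ (fun i => (u i).2.2) σ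

lemma proj_wedgeList_singleton (x : Homog 𝒲) : proj 𝒲 (wedgeList [x]) = x.2 :=
  proj_wedge_one 𝒲 _

lemma proj_wedgeList_of_length_ne_one (l : List (Homog 𝒲)) (hl : l.length ≠ 1) :
    proj 𝒲 (wedgeList l) = 0 := by
  rcases eq_or_ne l [] with rfl | h
  · simp
  · obtain ⟨n, u, rfl⟩ := exists_ofFn_eq l h
    rw [wedgeList_ofFn, proj_wedge_of_ne]
    rintro rfl
    exact hl List.length_ofFn

lemma proj_mem {p : ℤ} {c : CExt 𝒲} (hc : c ∈ extDeg 𝒲 p) : proj 𝒲 c ∈ 𝒲 p := by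
  refine (extDeg_le_iff (S := (𝒲 p).comap (proj 𝒲))).mpr (fun l hl => ?_) hc
  rw [Submodule.mem_comap]
  by_cases h : l.length = 1
  · obtain ⟨x, rfl⟩ := List.length_eq_one_iff.mp h
    rw [proj_wedgeList_singleton]
    obtain rfl : x.1 = p := by simpa using hl
    exact x.2.2
  · simp [proj_wedgeList_of_length_ne_one l h]

variable [DirectSum.Decomposition 𝒲]

lemma linearMap_ext_wedgeList {φ ψ : CExt 𝒲 →ₗ[K] N}
    (h : ∀ l : List (Homog 𝒲), φ (wedgeList l) = ψ (wedgeList l)) : φ = ψ := by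
  refine DirectSum.linearMap_ext K fun n => ?_
  refine Submodule.linearMap_qext _ (PiTensorProduct.ext ?_)
  refine multilinearMap_ext_homogeneous 𝒲 fun d w hw => ?_
  obtain ⟨u, rfl, rfl⟩ := exists_homog d w hw
  have := h (List.ofFn u)
  rw [wedgeList_ofFn] at this
  exact this

lemma koszulOp_wedgeList (k : ℤ) (l : List (Homog 𝒲)) :
    koszulOp 𝒲 k (wedgeList l) = (k * listDeg Sigma.fst l).negOnePow • wedgeList l :=
  koszulOp_of_mem 𝒲 k _ _ (wedgeList_mem l)

lemma comul_wedgeList_ofFn {n : ℕ} (u : Fin n → Homog 𝒲) :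
    comul 𝒲 (wedgeList (List.ofFn u)) = ∑ i : Fin n,
      unshuffleSum Sigma.fst u (fun A B => wedgeList A ⊗ₜ[K] wedgeList B) (i + 1) i.2 := by
  rcases n with _ | n
  · simp
  have last_eq_zero : unshuffleSum Sigma.fst u (fun A B => wedgeList A ⊗ₜ[K] wedgeList B)
      (Fin.last n + 1) (Fin.last n).2 = 0 := by
    refine Finset.sum_eq_zero fun σ _ => ?_
    have nil (g : Fin (n + 1 - (Fin.last n + 1)) → Homog 𝒲) : List.ofFn g = [] := by
      rw [← List.length_eq_zero_iff, List.length_ofFn, Fin.val_last, Nat.sub_self]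
    simp only [nil, wedgeList_nil, TensorProduct.tmul_zero, smul_zero]
  rw [Fin.sum_univ_castSucc, last_eq_zero, add_zero]
  refine (congrArg _ (wedgeList_ofFn (Nat.succPNat n) u)).trans <|
    (comul_wedge 𝒲 (Nat.succPNat n) _ _ fun a => (u a).2.2).trans ?_
  refine Finset.sum_congr rfl fun (i : Fin n) _ => Finset.sum_congr rfl fun σ _ => congrArg _ ?_
  exact congrArg₂ _ (wedgeList_ofFn ⟨i + 1, by omega⟩ _).symm
    (wedgeList_ofFn ⟨n + 1 - (i + 1), by omega⟩ _).symm

lemma comul_wedgeList (l : List (Homog 𝒲)) :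
    comul 𝒲 (wedgeList l) =
      splitSum Sigma.fst l fun A B => wedgeList A ⊗ₜ[K] wedgeList B := by
  obtain ⟨n, u, rfl⟩ : ∃ (n : ℕ) (u : Fin n → Homog 𝒲), l = List.ofFn u :=
    ⟨_, l.get, (List.ofFn_get l).symm⟩
  rw [comul_wedgeList_ofFn, sum_unshuffleSum_eq_splitSum _ _ _ fun B => by simp]

end wedgeList

/-! ### The extension of a linear map `ᶜ∧(W) → W` to `ᶜ∧(W)` -/

section flip

variable {R ι M N P : Type*} [CommSemiring R] [AddCommMonoid M] [Module R M] [AddCommMonoid N]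
  [Module R N] [AddCommMonoid P] [Module R P]

/-- The exchange of the arguments of a linear map with values in multilinear maps. -/
def flipMultilinear (f : M →ₗ[R] MultilinearMap R (fun _ : ι => N) P) :
    MultilinearMap R (fun _ : ι => N) (M →ₗ[R] P) where
  toFun u :=
    { toFun := fun x => f x u
      map_add' := fun x y => by rw [map_add]; rfl
      map_smul' := fun c x => by rw [map_smul]; rfl }
  map_update_add' u i x y := LinearMap.ext fun z => (f z).map_update_add u i x y
  map_update_smul' u i c x := LinearMap.ext fun z => (f z).map_update_smul u i c x

end flip

section coextend

variable {K : Type*} [Field K] {W : Type*} [AddCommGroup W] [Module K W]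
variable {N : Type*} [AddCommGroup N] [Module K N] (𝒲 : ℤ → Submodule K W)

/-- A family of multilinear maps is graded symmetric if permuting homogeneous arguments multiplies
its values by the Koszul sign. -/
def IsGradedSymm (F : ∀ n : ℕ+, MultilinearMap K (fun _ : Fin n => W) N) : Prop :=
  ∀ (n : ℕ+) (d : Fin n → ℤ) (w : Fin n → W), (∀ i, w i ∈ 𝒲 (d i)) →
    ∀ σ : Equiv.Perm (Fin n), F n w = koszul σ d • F n (w ∘ σ)

/-- The multilinear map `(u₁, …, uₙ) ↦ (w ↦ w ∧ u₁ ∧ ⋯ ∧ uₙ)`. -/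
def wedgeCons (n : ℕ) : MultilinearMap K (fun _ : Fin n => W) (W →ₗ[K] CExt 𝒲) :=
  flipMultilinear (wedge 𝒲 (Nat.succPNat n)).curryLeft

lemma wedgeCons_apply {n : ℕ} (u : Fin n → W) (w : W) :
    wedgeCons 𝒲 n u w = wedge 𝒲 (Nat.succPNat n) (Fin.cons (α := fun _ => W) w u) := rfl

variable {𝒲}

/-- The linear map `w ↦ w ∧ u₁ ∧ ⋯ ∧ uₙ` for a list `u₁, …, uₙ` of homogeneous elements, which is
allowed to be empty. -/
def consWedge (l : List (Homog 𝒲)) : W →ₗ[K] CExt 𝒲 :=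
  wedgeCons 𝒲 l.length fun a => (l.get a).2

lemma consWedge_apply_homog (l : List (Homog 𝒲)) (x : Homog 𝒲) :
    consWedge l x.2 = wedgeList (x :: l) := by
  rw [consWedge, wedgeCons_apply]
  refine congrArg (wedge 𝒲 (Nat.succPNat l.length)) (funext fun a => ?_)
  cases a using Fin.cases <;> rfl

lemma consWedge_apply_of_mem (l : List (Homog 𝒲)) {p : ℤ} {w : W} (hw : w ∈ 𝒲 p) :
    consWedge l w = wedgeList (⟨p, w, hw⟩ :: l) :=
  consWedge_apply_homog l ⟨p, w, hw⟩

lemma consWedge_mem (l : List (Homog 𝒲)) {p : ℤ} {w : W} (hw : w ∈ 𝒲 p) :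
    consWedge l w ∈ extDeg 𝒲 (p + listDeg Sigma.fst l) := by
  rw [consWedge_apply_of_mem l hw, ← listDeg_cons Sigma.fst (⟨p, w, hw⟩ : Homog 𝒲)]
  exact wedgeList_mem _

lemma proj_consWedge_nil (w : W) : proj 𝒲 (consWedge [] w) = w :=
  proj_wedge_one 𝒲 _

lemma proj_consWedge (l : List (Homog 𝒲)) (hl : l ≠ []) (w : W) :
    proj 𝒲 (consWedge l w) = 0 := by
  refine proj_wedge_of_ne 𝒲 (Nat.succPNat l.length) (fun h => hl ?_) _
  exact List.length_eq_zero_iff.mp (congrArg PNat.natPred h)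

variable (𝒲) [DirectSum.Decomposition 𝒲]

/-- The linear map `w₁ ∧ ⋯ ∧ wₙ ↦ F n (w₁, …, wₙ)` on `ᶜ∧(W)`. -/
def symmLift (F : ∀ n : ℕ+, MultilinearMap K (fun _ : Fin n => W) N) (hF : IsGradedSymm 𝒲 F) :
    CExt 𝒲 →ₗ[K] N :=
  CExt.lift 𝒲 fun n => extLift 𝒲 n (fun _ => F n) fun d w σ hw => hF n d w hw σ

lemma symmLift_comp_wedge (F : ∀ n : ℕ+, MultilinearMap K (fun _ : Fin n => W) N)
    (hF : IsGradedSymm 𝒲 F) (n : ℕ+) :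
    (symmLift 𝒲 F hF).compMultilinearMap (wedge 𝒲 n) = F n := by
  refine multilinearMap_ext_homogeneous 𝒲 fun d w hw => ?_
  simp only [symmLift, wedge, LinearMap.compMultilinearMap_apply, LinearMap.comp_apply,
    CExt.lift_incl]
  exact extLift_mk 𝒲 n _ _ d w hw

lemma isGradedSymm_wedgeCons : IsGradedSymm 𝒲 fun n => wedgeCons 𝒲 n := by
  intro n d u hu σ
  refine linearMap_ext_homogeneous 𝒲 fun p w hw => ?_
  refine (wedge_perm 𝒲 (Nat.succPNat n) (Fin.cons (α := fun _ => ℤ) p d)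
    (Fin.cons (α := fun _ => W) w u) (Fin.cases hw hu) (consPerm σ)).trans ?_
  exact congrArg₂ (fun (s : ℤˣ) z => s • wedge 𝒲 (Nat.succPNat n) z) (koszul_consPerm σ p d)
    (cons_comp_consPerm w u σ)

/-- The linear map `u₁ ∧ ⋯ ∧ uₙ ↦ (w ↦ w ∧ u₁ ∧ ⋯ ∧ uₙ)`. -/
def leftMul : CExt 𝒲 →ₗ[K] W →ₗ[K] CExt 𝒲 :=
  symmLift 𝒲 (fun n => wedgeCons 𝒲 n) (isGradedSymm_wedgeCons 𝒲)

variable {𝒲}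

lemma leftMul_wedgeList (l : List (Homog 𝒲)) (hl : l ≠ []) :
    leftMul 𝒲 (wedgeList l) = consWedge l := by
  let n : ℕ+ := ⟨l.length, List.length_pos_of_ne_nil hl⟩
  rw [wedgeList_eq_wedge n l rfl]
  exact congrArg (fun f => f fun a => ((l.get a).2 : W))
    (symmLift_comp_wedge 𝒲 _ (isGradedSymm_wedgeCons 𝒲) n)

/-- The linear map `w₁ ∧ ⋯ ∧ wₙ ↦ ∑ φ(w_{σ 1} ∧ ⋯ ∧ w_{σ i}) ∧ w_{σ (i + 1)} ∧ ⋯ ∧ w_{σ n}` on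
`ᶜ∧(W)`, where the sum is over all `1 ≤ i ≤ n` and all `(i, n - i)`-unshuffles, with Koszul signs.
The comultiplication provides the summands with `i < n`. -/
def coextend (φ : CExt 𝒲 →ₗ[K] W) : CExt 𝒲 →ₗ[K] CExt 𝒲 :=
  TensorProduct.lift ((leftMul 𝒲).flip ∘ₗ φ) ∘ₗ comul 𝒲 + consWedge [] ∘ₗ φ

lemma coextend_wedgeList (φ : CExt 𝒲 →ₗ[K] W) (l : List (Homog 𝒲)) :
    coextend φ (wedgeList l) =
      splitSum Sigma.fst l fun A B => consWedge B (φ (wedgeList A)) := by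
  have last_term := splitSum_of_right_ne_nil Sigma.fst l
    (fun A B => consWedge B (φ (wedgeList A)) - leftMul 𝒲 (wedgeList B) (φ (wedgeList A)))
    fun A B hB => by rw [leftMul_wedgeList B hB, sub_self]
  rw [wedgeList_nil, map_zero, LinearMap.zero_apply, sub_zero] at last_term
  rw [coextend, LinearMap.add_apply, LinearMap.comp_apply, LinearMap.comp_apply, comul_wedgeList,
    map_splitSum, ← last_term, ← splitSum_add]
  simp only [TensorProduct.lift.tmul, LinearMap.comp_apply, LinearMap.flip_apply,
    add_sub_cancel]

lemma proj_comp_coextend (φ : CExt 𝒲 →ₗ[K] W) : proj 𝒲 ∘ₗ coextend φ = φ := by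
  refine linearMap_ext_wedgeList fun l => ?_
  rw [LinearMap.comp_apply, coextend_wedgeList, map_splitSum,
    splitSum_of_right_ne_nil _ _ _ fun A B hB => proj_consWedge B hB _, proj_consWedge_nil]

end coextend

/-! ### The Euler operator and the kernel of the comultiplication -/

section euler

variable {K : Type*} [Field K] {W : Type*} [AddCommGroup W] [Module K W]
variable {𝒲 : ℤ → Submodule K W}

lemma one_mem_unshuffles {i n : ℕ} (hi : i ≤ n) : 1 ∈ unshuffles i n hi :=
  (mem_unshuffles_iff hi 1).mpr fun _ _ hab _ => hab

lemma unshuffleSum_wedgeList_append {i n : ℕ} (hi : i ≤ n) (u : Fin n → Homog 𝒲) :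
    unshuffleSum Sigma.fst u (fun A B => wedgeList (A ++ B)) i hi =
      (unshuffles i n hi).card • wedgeList (List.ofFn u) := by
  rw [unshuffleSum_eq_sum_take_drop, ← Finset.sum_const]
  refine Finset.sum_congr rfl fun σ _ => ?_
  rw [List.take_append_drop, ← wedgeList_eq_koszul_smul]

variable [DirectSum.Decomposition 𝒲]

lemma coextend_proj_wedgeList_ofFn {n : ℕ} (hn : 1 ≤ n) (u : Fin n → Homog 𝒲) :
    coextend (proj 𝒲) (wedgeList (List.ofFn u)) =
      (unshuffles 1 n hn).card • wedgeList (List.ofFn u) := by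
  rw [← unshuffleSum_wedgeList_append, unshuffleSum_eq_splitSum, coextend_wedgeList]
  refine splitSum_congr _ _ _ _ fun A B _ _ => ?_
  split_ifs with hA
  · obtain ⟨x, rfl⟩ := List.length_eq_one_iff.mp hA
    rw [proj_wedgeList_singleton, consWedge_apply_homog, List.singleton_append]
  · rw [proj_wedgeList_of_length_ne_one A hA, map_zero]

lemma coextend_proj_injective [CharZero K] : Function.Injective (coextend (proj 𝒲)) := by
  let inverse : CExt 𝒲 →ₗ[K] CExt 𝒲 :=
    CExt.lift 𝒲 fun n => ((unshuffles 1 n n.pos).card : K)⁻¹ • CExt.incl 𝒲 n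
  have inverse_comp : inverse ∘ₗ coextend (proj 𝒲) = LinearMap.id := by
    refine linearMap_ext_wedgeList fun l => ?_
    rcases eq_or_ne l [] with rfl | hl
    · simp
    · obtain ⟨n, u, rfl⟩ := exists_ofFn_eq l hl
      have card_ne_zero : ((unshuffles 1 n n.pos).card : K) ≠ 0 :=
        Nat.cast_ne_zero.mpr (Finset.card_ne_zero_of_mem (one_mem_unshuffles n.pos))
      rw [LinearMap.comp_apply, coextend_proj_wedgeList_ofFn n.pos, map_nsmul, wedgeList_ofFn,
        ← Nat.cast_smul_eq_nsmul K]
      refine (congrArg _ (CExt.lift_incl 𝒲 _ n _)).trans ?_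
      rw [LinearMap.smul_apply, smul_inv_smul₀ card_ne_zero]
      rfl
  exact Function.LeftInverse.injective (g := inverse) fun c => LinearMap.congr_fun inverse_comp c

lemma eq_zero_of_comul_eq_zero_of_proj_eq_zero [CharZero K] {c : CExt 𝒲} (hcomul : comul 𝒲 c = 0)
    (hproj : proj 𝒲 c = 0) : c = 0 :=
  (map_eq_zero_iff _ coextend_proj_injective).mp (by simp [coextend, hcomul, hproj])

end euler

/-! ### Coderivations and their corestrictions -/

section coderivations

variable {K : Type*} [Field K] {W : Type*} [AddCommGroup W] [Module K W]
variable {𝒲 : ℤ → Submodule K W} [DirectSum.Decomposition 𝒲]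

lemma koszulOp_comp_koszulOp (j k : ℤ) : koszulOp 𝒲 j ∘ₗ koszulOp 𝒲 k = koszulOp 𝒲 (j + k) := by
  refine linearMap_ext_wedgeList fun l => ?_
  rw [LinearMap.comp_apply, koszulOp_wedgeList, map_units_smul, koszulOp_wedgeList,
    koszulOp_wedgeList, smul_smul, add_mul, Int.negOnePow_add, mul_comm]

lemma comul_consWedge (l : List (Homog 𝒲)) {p : ℤ} {w : W} (hw : w ∈ 𝒲 p) :
    comul 𝒲 (consWedge l w) = splitSum Sigma.fst l fun A B =>
      consWedge A w ⊗ₜ[K] wedgeList B +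
        (p * listDeg Sigma.fst A).negOnePow • wedgeList A ⊗ₜ[K] consWedge B w := by
  simp only [consWedge_apply_of_mem _ hw, comul_wedgeList, splitSum]

section coextend

variable {k : ℤ} {φ : CExt 𝒲 →ₗ[K] W}

lemma coextend_mem_extDeg (hφ : ∀ p, ∀ c ∈ extDeg 𝒲 p, φ c ∈ 𝒲 (p + k)) {p : ℤ} {c : CExt 𝒲}
    (hc : c ∈ extDeg 𝒲 p) : coextend φ c ∈ extDeg 𝒲 (p + k) := by
  refine (extDeg_le_iff (S := (extDeg 𝒲 (p + k)).comap (coextend φ))).mpr (fun l hl => ?_) hc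
  rw [Submodule.mem_comap, coextend_wedgeList]
  refine splitSum_mem _ (extDeg 𝒲 (p + k)).toAddSubgroup l _ fun A B hAB => ?_
  have mem := consWedge_mem B (hφ _ _ (wedgeList_mem A))
  rwa [add_right_comm, hAB, hl] at mem

lemma map_coextend_id_wedgeList_tmul (E D : List (Homog 𝒲)) :
    TensorProduct.map (coextend φ) LinearMap.id (wedgeList E ⊗ₜ[K] wedgeList D) =
      splitSum Sigma.fst E fun A C => consWedge C (φ (wedgeList A)) ⊗ₜ[K] wedgeList D := by
  rw [TensorProduct.map_tmul, coextend_wedgeList]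
  exact map_splitSum _ ((TensorProduct.mk K (CExt 𝒲) (CExt 𝒲)).flip (wedgeList D)) _ _

lemma map_koszulOp_coextend_wedgeList_tmul (C E : List (Homog 𝒲)) :
    TensorProduct.map (koszulOp 𝒲 k) (coextend φ) (wedgeList C ⊗ₜ[K] wedgeList E) =
      splitSum Sigma.fst E fun A D => (k * listDeg Sigma.fst C).negOnePow •
        wedgeList C ⊗ₜ[K] consWedge D (φ (wedgeList A)) := by
  rw [TensorProduct.map_tmul, coextend_wedgeList, koszulOp_wedgeList, ← smul_splitSum]
  refine (map_units_smul ((TensorProduct.mk K (CExt 𝒲) (CExt 𝒲)).flip _) _ _).trans ?_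
  exact congrArg _ (map_splitSum _ (TensorProduct.mk K (CExt 𝒲) (CExt 𝒲) (wedgeList C)) _ _)

/-- Both sides of the Leibniz rule are sums over the splittings of a list into three parts: the
argument `A` of `φ` and the remaining elements `C` and `D` of the left and right tensor factors. -/
lemma isCoderivation_coextend (hφ : ∀ p, ∀ c ∈ extDeg 𝒲 p, φ c ∈ 𝒲 (p + k)) :
    IsCoderivation 𝒲 k (coextend φ) where
  degree _ _ := coextend_mem_extDeg hφ
  leibniz c := by
    suffices comul 𝒲 ∘ₗ coextend φ = TensorProduct.map (coextend φ) LinearMap.id ∘ₗ comul 𝒲 +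
        TensorProduct.map (koszulOp 𝒲 k) (coextend φ) ∘ₗ comul 𝒲 from LinearMap.congr_fun this c
    refine linearMap_ext_wedgeList fun l => ?_
    simp only [LinearMap.add_apply, LinearMap.comp_apply, coextend_wedgeList, comul_wedgeList,
      map_splitSum, map_coextend_id_wedgeList_tmul, map_koszulOp_coextend_wedgeList_tmul]
    simp only [comul_consWedge _ (hφ _ _ (wedgeList_mem _)), splitSum_add]
    congr 1
    · exact splitSum_assoc _ _ fun A C D => consWedge C (φ (wedgeList A)) ⊗ₜ[K] wedgeList D
    · rw [splitSum_assoc, splitSum_assoc]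
      refine splitSum_congr _ _ _ _ fun E D _ _ => ?_
      rw [splitSum_comm _ E]
      refine splitSum_congr _ _ _ _ fun C A _ _ => ?_
      rw [smul_smul, ← Int.negOnePow_add]
      refine congrArg (· • _) ((Int.negOnePow_eq_iff _ _).mpr ⟨listDeg Sigma.fst C *
        listDeg Sigma.fst A, ?_⟩)
      ring

end coextend

namespace IsCoderivation

variable {k : ℤ} {θ θ' : CExt 𝒲 →ₗ[K] CExt 𝒲}

lemma sub (hθ : IsCoderivation 𝒲 k θ) (hθ' : IsCoderivation 𝒲 k θ') :
    IsCoderivation 𝒲 k (θ - θ') where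
  degree p c hc := sub_mem (hθ.degree p c hc) (hθ'.degree p c hc)
  leibniz c := by
    have map_sub_left :=
      (TensorProduct.mapBilinear (.id K) _ _ _ _).map_sub₂ θ θ' (LinearMap.id : CExt 𝒲 →ₗ[K] CExt 𝒲)
    have map_sub_right := (TensorProduct.mapBilinear (.id K) _ _ _ _ (koszulOp 𝒲 k)).map_sub θ θ'
    simp only [TensorProduct.mapBilinear_apply] at map_sub_left map_sub_right
    simp only [map_sub_left, map_sub_right, LinearMap.sub_apply, map_sub, hθ.leibniz, hθ'.leibniz]
    abel

lemma koszulOp_comp_of_odd (hk : Odd k) (hθ : IsCoderivation 𝒲 k θ) :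
    koszulOp 𝒲 k ∘ₗ θ = -(θ ∘ₗ koszulOp 𝒲 k) := by
  refine linearMap_ext_wedgeList fun l => ?_
  rw [LinearMap.neg_apply, LinearMap.comp_apply, LinearMap.comp_apply,
    koszulOp_of_mem 𝒲 k _ _ (hθ.degree _ _ (wedgeList_mem l)), koszulOp_wedgeList,
    map_units_smul, mul_add, Int.negOnePow_add, Int.negOnePow_odd _ (hk.mul hk), mul_neg_one,
    Units.neg_smul]

lemma comp_self (hk : Odd k) (hθ : IsCoderivation 𝒲 k θ) :
    IsCoderivation 𝒲 (k + k) (θ ∘ₗ θ) where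
  degree p c hc := by
    rw [← add_assoc]
    exact hθ.degree _ _ (hθ.degree p c hc)
  leibniz c := by
    have cross_terms_cancel : TensorProduct.map θ LinearMap.id ∘ₗ
          TensorProduct.map (koszulOp 𝒲 k) θ =
        -(TensorProduct.map (koszulOp 𝒲 k) θ ∘ₗ TensorProduct.map θ LinearMap.id) := by
      have map_neg_left :=
        (TensorProduct.mapBilinear (.id K) _ _ _ _).map_neg₂ (θ ∘ₗ koszulOp 𝒲 k) θ
      simp only [TensorProduct.mapBilinear_apply] at map_neg_left
      rw [← TensorProduct.map_comp, ← TensorProduct.map_comp, koszulOp_comp_of_odd hk hθ,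
        LinearMap.comp_id, LinearMap.id_comp, map_neg_left, neg_neg]
    have cancel_apply := LinearMap.congr_fun cross_terms_cancel (comul 𝒲 c)
    rw [LinearMap.neg_apply, LinearMap.comp_apply, LinearMap.comp_apply] at cancel_apply
    rw [LinearMap.comp_apply, hθ.leibniz, hθ.leibniz, map_add, map_add, cancel_apply,
      ← koszulOp_comp_koszulOp, TensorProduct.map_comp, ← LinearMap.id_comp (LinearMap.id),
      TensorProduct.map_comp]
    simp only [LinearMap.comp_apply, LinearMap.id_comp]
    abel

variable [CharZero K]

lemma eq_zero_of_proj_comp_eq_zero (hθ : IsCoderivation 𝒲 k θ) (hproj : proj 𝒲 ∘ₗ θ = 0) :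
    θ = 0 := by
  refine linearMap_ext_wedgeList fun l => ?_
  induction hn : l.length using Nat.strong_induction_on generalizing l with
  | _ n ih =>
    refine eq_zero_of_comul_eq_zero_of_proj_eq_zero ?_ (LinearMap.congr_fun hproj _)
    rw [hθ.leibniz, comul_wedgeList, map_splitSum, map_splitSum, ← splitSum_add,
      ← splitSum_zero Sigma.fst l]
    refine splitSum_congr _ _ _ _ fun A B _ hlen => ?_
    rw [TensorProduct.map_tmul, TensorProduct.map_tmul]
    rcases eq_or_ne A [] with rfl | hA
    · simp
    rcases eq_or_ne B [] with rfl | hB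
    · simp
    have hA := List.length_pos_of_ne_nil hA
    have hB := List.length_pos_of_ne_nil hB
    rw [ih A.length (by omega) A rfl, ih B.length (by omega) B rfl]
    simp

lemma coextend_proj_comp (hθ : IsCoderivation 𝒲 k θ) : coextend (proj 𝒲 ∘ₗ θ) = θ := by
  have isCoderivation := isCoderivation_coextend (φ := proj 𝒲 ∘ₗ θ) (k := k)
    fun p c hc => proj_mem (hθ.degree p c hc)
  refine sub_eq_zero.mp ((isCoderivation.sub hθ).eq_zero_of_proj_comp_eq_zero ?_)
  rw [LinearMap.comp_sub, proj_comp_coextend, sub_self]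

lemma comp_self_eq_zero_iff (hk : Odd k) (hθ : IsCoderivation 𝒲 k θ) :
    θ ∘ₗ θ = 0 ↔ proj 𝒲 ∘ₗ θ ∘ₗ θ = 0 :=
  ⟨fun h => by rw [h, LinearMap.comp_zero], (hθ.comp_self hk).eq_zero_of_proj_comp_eq_zero⟩

end IsCoderivation

end coderivations

/-! ### Symmetric brackets of degree one and differentials -/

section shiftedBrackets

variable {K : Type*} [Field K] {W : Type*} [AddCommGroup W] [Module K W]

/-- The `n`-th bracket of the family `f` is homogeneous of degree `k n`. -/
def HasDegree (𝒲 : ℤ → Submodule K W) (f : ∀ n : ℕ+, MultilinearMap K (fun _ : Fin n => W) W)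
    (k : ℕ+ → ℤ) : Prop :=
  ∀ (n : ℕ+) (d : Fin n → ℤ) (w : Fin n → W), (∀ i, w i ∈ 𝒲 (d i)) → f n w ∈ 𝒲 (∑ i, d i + k n)

/-- The composite `f_{n-i}(f_{i+1}(w_0, …, w_i), w_{i+1}, …, w_{n-1})`. -/
def insertFirst (f : ∀ n : ℕ+, MultilinearMap K (fun _ : Fin n => W) W) {n : ℕ} (i : Fin n)
    (w : Fin n → W) : W :=
  f (Nat.succPNat (n - (i + 1))) (Fin.cons (α := fun _ => W)
    (f (Nat.succPNat i) fun a => w (split (i + 1) n i.2 (Sum.inl a)))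
    fun b => w (split (i + 1) n i.2 (Sum.inr b)))

/-- An `L∞[1]`-algebra structure on `W`: graded symmetric brackets of degree `1` satisfying the
Jacobi identities without the signs of the suspended convention. -/
structure IsShiftedLInf (𝒲 : ℤ → Submodule K W)
    (f : ∀ n : ℕ+, MultilinearMap K (fun _ : Fin n => W) W) : Prop where
  degree : HasDegree 𝒲 f fun _ => 1
  symm : IsGradedSymm 𝒲 f
  jacobi : ∀ (n : ℕ) (d : Fin n → ℤ) (w : Fin n → W), (∀ i, w i ∈ 𝒲 (d i)) →
    ∑ i : Fin n, ∑ σ ∈ unshuffles (i + 1) n i.2, koszul σ d • insertFirst f i (w ∘ σ) = 0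

variable {𝒲 : ℤ → Submodule K W}

lemma consWedge_ofFn {n : ℕ} (u : Fin n → Homog 𝒲) :
    consWedge (List.ofFn u) = wedgeCons 𝒲 n fun a => ((u a).2 : W) := by
  have of_length_eq (l : List (Homog 𝒲)) (hl : n = l.length) :
      consWedge l = wedgeCons 𝒲 n fun a => ((l.get (a.cast hl)).2 : W) := by
    subst hl
    rfl
  rw [of_length_eq _ List.length_ofFn.symm]
  congr 1
  funext a
  exact congrArg (fun z : Homog 𝒲 => (z.2 : W)) (List.get_ofFn u _)

lemma isGradedSymm_compMultilinearMap_wedge {N : Type*} [AddCommGroup N] [Module K N]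
    (φ : CExt 𝒲 →ₗ[K] N) : IsGradedSymm 𝒲 fun n => φ.compMultilinearMap (wedge 𝒲 n) :=
  fun n d w hw σ => (congrArg φ (wedge_perm 𝒲 n d w hw σ)).trans (map_units_smul φ _ _)

lemma forall_mem_extDeg_iff {k : ℤ} {φ : CExt 𝒲 →ₗ[K] W} :
    (∀ p, ∀ c ∈ extDeg 𝒲 p, φ c ∈ 𝒲 (p + k)) ↔
      HasDegree 𝒲 (fun n => φ.compMultilinearMap (wedge 𝒲 n)) fun _ => k := by
  refine ⟨fun h n d w hw => h _ _ (Submodule.subset_span ⟨n, d, w, hw, rfl, rfl⟩),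
    fun h p c hc => ?_⟩
  refine Submodule.span_le (p := (𝒲 (p + k)).comap φ).mpr ?_ hc
  rintro _ ⟨n, d, w, hw, rfl, rfl⟩
  exact h n d w hw

variable [DirectSum.Decomposition 𝒲]

lemma symmLift_compMultilinearMap_wedge {N : Type*} [AddCommGroup N] [Module K N]
    (φ : CExt 𝒲 →ₗ[K] N) :
    symmLift 𝒲 (fun n => φ.compMultilinearMap (wedge 𝒲 n))
      (isGradedSymm_compMultilinearMap_wedge φ) = φ := by
  refine linearMap_ext_wedgeList fun l => ?_
  rcases eq_or_ne l [] with rfl | hl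
  · simp
  · obtain ⟨n, u, rfl⟩ := exists_ofFn_eq l hl
    rw [wedgeList_ofFn]
    exact DFunLike.congr_fun (symmLift_comp_wedge 𝒲 (fun n => φ.compMultilinearMap (wedge 𝒲 n))
      (isGradedSymm_compMultilinearMap_wedge φ) n) fun a => ((u a).2 : W)

lemma corestriction_coextend (φ : CExt 𝒲 →ₗ[K] W) (n : ℕ+) :
    corestriction 𝒲 (coextend φ) n = φ.compMultilinearMap (wedge 𝒲 n) := by
  rw [corestriction, proj_comp_coextend]

lemma isCoderivation_coextend_iff {k : ℤ} {φ : CExt 𝒲 →ₗ[K] W} :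
    IsCoderivation 𝒲 k (coextend φ) ↔ ∀ p, ∀ c ∈ extDeg 𝒲 p, φ c ∈ 𝒲 (p + k) := by
  refine ⟨fun h p c hc => ?_, isCoderivation_coextend⟩
  rw [← proj_comp_coextend φ]
  exact proj_mem (h.degree p c hc)

lemma apply_coextend_wedgeList_ofFn (φ : CExt 𝒲 →ₗ[K] W) {n : ℕ} (u : Fin n → Homog 𝒲) :
    φ (coextend φ (wedgeList (List.ofFn u))) =
      ∑ i : Fin n, ∑ σ ∈ unshuffles (i + 1) n i.2, koszul σ (Sigma.fst ∘ u) •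
        insertFirst (fun n => φ.compMultilinearMap (wedge 𝒲 n)) i
          ((fun a => ((u a).2 : W)) ∘ σ) := by
  rw [coextend_wedgeList, map_splitSum, ← sum_unshuffleSum_eq_splitSum _ _ _ fun B => by simp]
  refine Finset.sum_congr rfl fun i _ => Finset.sum_congr rfl fun σ _ => congrArg _ ?_
  refine (congrArg (fun f : W →ₗ[K] CExt 𝒲 => φ (f (φ _))) (consWedge_ofFn _)).trans ?_
  exact congrArg (fun z => φ (wedge 𝒲 (Nat.succPNat (n - (i + 1))) (Fin.cons (φ z) _)))
    (wedgeList_ofFn (Nat.succPNat i) _)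

variable [CharZero K]

lemma coextend_comp_self_eq_zero_iff {φ : CExt 𝒲 →ₗ[K] W} {k : ℤ} (hk : Odd k)
    (hφ : IsCoderivation 𝒲 k (coextend φ)) :
    coextend φ ∘ₗ coextend φ = 0 ↔
      ∀ (n : ℕ) (d : Fin n → ℤ) (w : Fin n → W), (∀ i, w i ∈ 𝒲 (d i)) →
        ∑ i : Fin n, ∑ σ ∈ unshuffles (i + 1) n i.2, koszul σ d •
          insertFirst (fun n => φ.compMultilinearMap (wedge 𝒲 n)) i (w ∘ σ) = 0 := by
  rw [hφ.comp_self_eq_zero_iff hk, ← LinearMap.comp_assoc, proj_comp_coextend]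
  refine ⟨fun h n d w hw => ?_, fun h => linearMap_ext_wedgeList fun l => ?_⟩
  · obtain ⟨u, rfl, rfl⟩ := exists_homog d w hw
    rw [← apply_coextend_wedgeList_ofFn]
    exact LinearMap.congr_fun h _
  · rw [← List.ofFn_get l, LinearMap.comp_apply, apply_coextend_wedgeList_ofFn]
    exact h _ _ _ fun a => (l.get a).2.2

lemma coextend_mem_coDiff_iff (φ : CExt 𝒲 →ₗ[K] W) :
    coextend φ ∈ CoDiff 𝒲 ↔ IsShiftedLInf 𝒲 fun n => φ.compMultilinearMap (wedge 𝒲 n) := by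
  constructor
  · rintro ⟨hφ, hsq⟩
    exact ⟨forall_mem_extDeg_iff.mp (isCoderivation_coextend_iff.mp hφ),
      isGradedSymm_compMultilinearMap_wedge φ,
      (coextend_comp_self_eq_zero_iff odd_one hφ).mp hsq⟩
  · intro h
    have hφ := isCoderivation_coextend_iff.mpr (forall_mem_extDeg_iff.mpr h.degree)
    exact ⟨hφ, (coextend_comp_self_eq_zero_iff odd_one hφ).mpr h.jacobi⟩

variable (𝒲)

/-- The bijection between `L∞[1]`-algebra structures and differentials which sends a differential to
its corestrictions. -/
def coDiffEquivShiftedLInf : CoDiff 𝒲 ≃ {f // IsShiftedLInf 𝒲 f} where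
  toFun θ := ⟨corestriction 𝒲 θ.1, by
    refine (coextend_mem_coDiff_iff (proj 𝒲 ∘ₗ θ.1)).mp ?_
    rw [θ.2.1.coextend_proj_comp]
    exact θ.2⟩
  invFun f := ⟨coextend (symmLift 𝒲 f.1 f.2.symm), by
    rw [coextend_mem_coDiff_iff]
    simpa only [symmLift_comp_wedge] using f.2⟩
  left_inv θ := Subtype.ext <|
    (congrArg coextend (symmLift_compMultilinearMap_wedge (proj 𝒲 ∘ₗ θ.1))).trans
      θ.2.1.coextend_proj_comp
  right_inv f := Subtype.ext <| funext fun n =>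
    (corestriction_coextend _ n).trans (symmLift_comp_wedge 𝒲 f.1 f.2.symm n)

end shiftedBrackets

/-! ### The sign of `↓ ⊗ ⋯ ⊗ ↓` -/

section signs

lemma desuspSign_eq_prod {n : ℕ} (d : Fin n → ℤ) :
    desuspSign d = ∏ a, ∏ b, if a < b then (d a).negOnePow else 1 := by
  refine Finset.prod_congr rfl fun a _ => ?_
  have card_gt : (Finset.univ.filter fun b => a < b).card = n - 1 - a := by
    rw [← Fin.card_Ioi]
    congr 1
    ext b
    simp
  rw [← Finset.prod_filter, ← negOnePow_sum, Finset.sum_const, card_gt, nsmul_eq_mul]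
  congr 2
  omega

lemma desuspSign_eq_prod_min {n : ℕ} (σ : Equiv.Perm (Fin n)) (d : Fin n → ℤ) :
    desuspSign d = ∏ a, ∏ b, if a < b then (d (min (σ a) (σ b))).negOnePow else 1 := by
  rw [← prod_order_eq (fun a b => (d (min (σ a) (σ b))).negOnePow)
    (fun a b => by rw [min_comm]) σ, desuspSign_eq_prod, ← Equiv.prod_comp σ]
  refine Finset.prod_congr rfl fun a _ => ?_
  rw [← Equiv.prod_comp σ]
  refine Finset.prod_congr rfl fun b _ => ?_
  by_cases hab : σ a < σ b
  · simp [hab, min_eq_left hab.le]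
  · simp [hab]

lemma sign_eq_prod {n : ℕ} (σ : Equiv.Perm (Fin n)) :
    Equiv.Perm.sign σ = ∏ a, ∏ b, if a < b then (if σ a < σ b then 1 else -1 : ℤˣ) else 1 := by
  rw [Equiv.Perm.sign_eq_prod_prod_Ioi]
  refine Finset.prod_congr rfl fun a _ => ?_
  rw [← Finset.prod_filter]
  refine Finset.prod_congr ?_ fun _ _ => rfl
  ext b
  simp

lemma koszul_mul_desuspSign {n : ℕ} (σ : Equiv.Perm (Fin n)) (d : Fin n → ℤ) :
    koszul σ (fun a => d a - 1) * desuspSign (d ∘ σ) = antiKoszul σ d * desuspSign d := by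
  rw [desuspSign_eq_prod_min σ d, antiKoszul, sign_eq_prod, desuspSign_eq_prod]
  unfold koszul
  simp only [← Finset.prod_mul_distrib]
  refine Finset.prod_congr rfl fun a _ => Finset.prod_congr rfl fun b _ => ?_
  by_cases hab : a < b
  · rcases lt_or_gt_of_ne (σ.injective.ne hab.ne) with h | h
    · simp [hab, h, h.not_gt, min_eq_left h.le]
    · simp only [hab, h, h.not_gt, min_eq_right h.le, if_true, if_false, and_self,
        Function.comp_apply]
      rw [← Int.negOnePow_one, ← Int.negOnePow_add, ← Int.negOnePow_add, ← Int.negOnePow_add,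
        Int.negOnePow_eq_iff]
      exact ⟨-d (σ b), by ring⟩
  · simp [hab]

lemma desuspSign_cons {n : ℕ} (x : ℤ) (d : Fin n → ℤ) :
    desuspSign (Fin.cons x d : Fin (n + 1) → ℤ) = (n * x).negOnePow * desuspSign d := by
  rw [desuspSign, Fin.prod_univ_succ]
  simp [desuspSign]

lemma desuspSign_eq_mul_split {n i : ℕ} (hi : i ≤ n) (d : Fin n → ℤ) :
    desuspSign d = (((n - i : ℕ) : ℤ) * ∑ a, d (split i n hi (Sum.inl a))).negOnePow *
      (desuspSign (fun a => d (split i n hi (Sum.inl a))) *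
        desuspSign fun b => d (split i n hi (Sum.inr b))) := by
  rw [desuspSign, ← Equiv.prod_comp (split i n hi), Fintype.prod_sum_type, ← mul_assoc]
  simp only [split_inl_val, split_inr_val, desuspSign, Finset.mul_sum, negOnePow_sum,
    ← Finset.prod_mul_distrib, ← Int.negOnePow_add]
  congr 1 <;> refine Finset.prod_congr rfl fun a _ => congrArg _ ?_ <;> push_cast [hi] <;> ring

/-- The sign `(-1)^{n(n+1)/2} (-1)^{∑ (n - i) dᵢ}` relating `lₙ` to the `n`-th corestriction. -/
def twistSign {n : ℕ} (d : Fin n → ℤ) : ℤˣ := (-1) ^ (n + 1).choose 2 * desuspSign d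

lemma koszul_mul_twistSign {n : ℕ} (σ : Equiv.Perm (Fin n)) (d : Fin n → ℤ) :
    koszul σ (fun a => d a - 1) * twistSign (d ∘ σ) = antiKoszul σ d * twistSign d := by
  rw [twistSign, twistSign, mul_left_comm, koszul_mul_desuspSign, mul_left_comm]

lemma choose_two_add (j m : ℕ) :
    (j + m + 1).choose 2 = (j + 1).choose 2 + (m + 1).choose 2 + m * j := by
  induction m with
  | zero => simp
  | succ m ih =>
    rw [Nat.choose_succ_succ' (m + 1) 1, Nat.choose_succ_succ' (j + (m + 1)) 1, ← add_assoc j m 1,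
      ih, Nat.choose_one_right, Nat.choose_one_right]
    ring

lemma neg_one_pow_choose_two_mul (r i : ℕ) :
    (-1 : ℤˣ) ^ (r + 2).choose 2 * (-1) ^ (i + 2).choose 2 * (r * (1 - i) : ℤ).negOnePow =
      (-1) ^ (r + i + 2) * (-1) ^ (i + 1) * (-1) ^ (r + i + 2).choose 2 := by
  have negOnePow_natCast (m : ℕ) : (-1 : ℤˣ) ^ m = (m : ℤ).negOnePow := rfl
  have choose_eq : (((r + i + 2).choose 2 : ℕ) : ℤ) + (r + i + 2) =
      (r + 2).choose 2 + (i + 2).choose 2 + (i + 1) * (r + 1) := by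
    have h := choose_two_add (r + 1) (i + 1)
    rw [show r + 1 + (i + 1) + 1 = (r + i + 2) + 1 by ring, Nat.choose_succ_succ' _ 1,
      Nat.choose_one_right] at h
    exact_mod_cast (add_comm _ _).trans h
  simp only [negOnePow_natCast, ← Int.negOnePow_add]
  rw [Int.negOnePow_eq_iff]
  refine ⟨r - (i + 1) * (r + 1), ?_⟩
  push_cast
  linear_combination -choose_eq

lemma twistSign_cons_mul_twistSign {n i : ℕ} (hi : i < n) (d : Fin n → ℤ) :
    twistSign (Fin.cons (∑ a, d (split (i + 1) n hi (Sum.inl a)) + (2 - ((i + 1 : ℕ) : ℤ)))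
      (fun b => d (split (i + 1) n hi (Sum.inr b))) : Fin (n - (i + 1) + 1) → ℤ) *
        twistSign (fun a => d (split (i + 1) n hi (Sum.inl a))) =
      (-1) ^ (n + 1) * (-1) ^ (i + 1) * twistSign d := by
  obtain ⟨r, rfl⟩ : ∃ r, n = r + (i + 1) := ⟨n - (i + 1), by omega⟩
  have sub_eq : r + (i + 1) - (i + 1) = r := Nat.add_sub_cancel ..
  have parity := neg_one_pow_choose_two_mul r i
  have degree_eq (s : ℤ) : (r * (s + (2 - ((i + 1 : ℕ) : ℤ)))).negOnePow =
      (r * s).negOnePow * (r * (1 - i) : ℤ).negOnePow := by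
    rw [← Int.negOnePow_add]
    congr 1
    push_cast
    ring
  simp only [twistSign, desuspSign_cons, desuspSign_eq_mul_split (i := i + 1) hi d, sub_eq,
    degree_eq]
  generalize (r * ∑ a, d (split (i + 1) (r + (i + 1)) hi (Sum.inl a)) : ℤ).negOnePow = s
  generalize (r * (1 - i) : ℤ).negOnePow = t at parity ⊢
  rw [← mul_assoc _ _ (s * _), show r + (i + 1) + 1 = r + i + 2 by ring, ← parity]
  ac_rfl

end signs

/-! ### `L∞`-algebras as shifted `L∞`-algebras -/

section correspondence

variable {K : Type*} [Field K] {V : Type*} [AddCommGroup V] [Module K V]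
variable {𝒱 : ℤ → Submodule K V}

lemma map_cons_units_smul {m : ℕ} (F : MultilinearMap K (fun _ : Fin (m + 1) => V) V) (s : ℤˣ)
    (x : V) (u : Fin m → V) :
    F (Fin.cons (α := fun _ => V) (s • x) u) = s • F (Fin.cons (α := fun _ => V) x u) :=
  congrArg (fun φ => φ u) (map_units_smul F.curryLeft s x)

lemma units_smul_mem_iff {P : Submodule K V} (s : ℤˣ) {x : V} : s • x ∈ P ↔ x ∈ P := by
  rcases Int.units_eq_one_or s with rfl | rfl <;> simp

lemma forall_homogeneous_desusp_iff {n : ℕ} {P : (Fin n → ℤ) → (Fin n → V) → Prop} :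
    (∀ (d : Fin n → ℤ) (v : Fin n → V), (∀ i, v i ∈ desusp 𝒱 (d i)) → P d v) ↔
      ∀ (d : Fin n → ℤ) (v : Fin n → V), (∀ i, v i ∈ 𝒱 (d i)) → P (fun i => d i - 1) v := by
  refine ⟨fun h d v hv => h _ v fun i => ?_, fun h d v hv => ?_⟩
  · simpa only [desusp, sub_add_cancel] using hv i
  · simpa only [add_sub_cancel_right] using h (fun i => d i + 1) v hv

variable [DirectSum.Decomposition 𝒱]

variable (𝒱) in
/-- The family `↓⁻¹ ∘ gₙ ∘ ↓^{⊗n}`, up to the sign `(-1)^{n(n+1)/2}`, for `g` on `↓V`; as this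
operation is an involution, it also goes from families on `V` to families on `↓V`. -/
def twist (g : ∀ n : ℕ+, MultilinearMap K (fun _ : Fin n => V) V) (n : ℕ+) :
    MultilinearMap K (fun _ : Fin n => V) V :=
  homExt 𝒱 fun d => twistSign d • g n

variable (g : ∀ n : ℕ+, MultilinearMap K (fun _ : Fin n => V) V)

lemma twist_apply (n : ℕ+) {d : Fin n → ℤ} {v : Fin n → V} (hv : ∀ i, v i ∈ 𝒱 (d i)) :
    twist 𝒱 g n v = twistSign d • g n v :=
  homExt_apply 𝒱 _ d v hv

lemma twist_twist : twist 𝒱 (twist 𝒱 g) = g := by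
  funext n
  refine multilinearMap_ext_homogeneous 𝒱 fun d v hv => ?_
  rw [twist_apply _ n hv, twist_apply _ n hv, smul_smul, Int.units_mul_self, one_smul]

lemma hasDegree_twist_iff :
    HasDegree (desusp 𝒱) (twist 𝒱 g) (fun _ => 1) ↔ HasDegree 𝒱 g fun n => 2 - n := by
  refine forall_congr' fun n => forall_homogeneous_desusp_iff.trans ?_
  refine forall₃_congr fun d v hv => ?_
  have degree_eq : ∑ i, (d i - 1) + 1 + 1 = ∑ i, d i + (2 - (n : ℤ)) := by
    simp only [Finset.sum_sub_distrib, Finset.sum_const, Finset.card_univ, Fintype.card_fin,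
      nsmul_eq_mul, mul_one]
    ring
  rw [twist_apply g n hv, desusp, units_smul_mem_iff, degree_eq]

lemma isGradedSymm_twist_iff :
    IsGradedSymm (desusp 𝒱) (twist 𝒱 g) ↔
      ∀ (n : ℕ+) (d : Fin n → ℤ) (v : Fin n → V), (∀ i, v i ∈ 𝒱 (d i)) →
        ∀ σ : Equiv.Perm (Fin n), g n (v ∘ σ) = antiKoszul σ d • g n v := by
  refine forall_congr' fun n => forall_homogeneous_desusp_iff.trans ?_
  refine forall₃_congr fun d v hv => forall_congr' fun σ => ?_
  rw [twist_apply g n hv, twist_apply g n (d := d ∘ σ) (v := v ∘ σ) fun i => hv (σ i), smul_smul,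
    koszul_mul_twistSign, mul_comm, mul_smul, smul_left_cancel_iff, ← inv_smul_eq_iff,
    Int.units_inv_eq_self, eq_comm]

variable {g}

lemma insertFirst_twist
    (hg : HasDegree 𝒱 g fun n => 2 - n) {n : ℕ} {d : Fin n → ℤ} {v : Fin n → V}
    (hv : ∀ i, v i ∈ 𝒱 (d i)) (i : Fin n) :
    insertFirst (twist 𝒱 g) i v =
      ((-1) ^ (n + 1) * (-1) ^ ((i : ℕ) + 1) * twistSign d) • insertFirst g i v := by
  have inner_mem := hg (Nat.succPNat i) _ _ fun a => hv (split (i + 1) n i.2 (Sum.inl a))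
  rw [← twistSign_cons_mul_twistSign i.2, mul_comm, mul_smul, insertFirst,
    twist_apply g (Nat.succPNat i) fun a => hv (split (i + 1) n i.2 (Sum.inl a))]
  refine (map_cons_units_smul (twist 𝒱 g (Nat.succPNat (n - (i + 1)))) _ _ _).trans ?_
  refine congrArg _ (twist_apply g (Nat.succPNat (n - (i + 1))) ?_)
  exact Fin.cases inner_mem fun b => hv (split (i + 1) n i.2 (Sum.inr b))

lemma sum_koszul_smul_insertFirst_twist
    (hg : HasDegree 𝒱 g fun n => 2 - n) {n : ℕ} {d : Fin n → ℤ} {v : Fin n → V}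
    (hv : ∀ i, v i ∈ 𝒱 (d i)) :
    ∑ i : Fin n, ∑ σ ∈ unshuffles (i + 1) n i.2,
        koszul σ (fun a => d a - 1) • insertFirst (twist 𝒱 g) i (v ∘ σ) =
      ((-1) ^ (n + 1) * twistSign d) • ∑ i : Fin n, (-1 : ℤˣ) ^ ((i : ℕ) + 1) •
        ∑ σ ∈ unshuffles (i + 1) n i.2, antiKoszul σ d • insertFirst g i (v ∘ σ) := by
  simp only [Finset.smul_sum]
  refine Finset.sum_congr rfl fun i _ => Finset.sum_congr rfl fun σ _ => ?_
  rw [insertFirst_twist hg (d := d ∘ σ) (v := v ∘ σ) fun a => hv (σ a), smul_smul,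
    mul_left_comm,
    koszul_mul_twistSign, smul_smul, smul_smul]
  congr 1
  ac_rfl

lemma twist_jacobi_iff
    (hg : HasDegree 𝒱 g fun n => 2 - n) :
    (∀ (n : ℕ) (d : Fin n → ℤ) (v : Fin n → V), (∀ i, v i ∈ desusp 𝒱 (d i)) →
        ∑ i : Fin n, ∑ σ ∈ unshuffles (i + 1) n i.2,
          koszul σ d • insertFirst (twist 𝒱 g) i (v ∘ σ) = 0) ↔
      ∀ (n : ℕ) (_ : 1 ≤ n) (d : Fin n → ℤ) (v : Fin n → V), (∀ i, v i ∈ 𝒱 (d i)) →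
        ∑ i : Fin n, (-1 : ℤˣ) ^ ((i : ℕ) + 1) • ∑ σ ∈ unshuffles (i + 1) n i.2,
          antiKoszul σ d • insertFirst g i (v ∘ σ) = 0 := by
  refine forall_congr' fun n => forall_homogeneous_desusp_iff.trans ?_
  rcases Nat.eq_zero_or_pos n with rfl | hn
  · simp
  · rw [forall_prop_of_true (Nat.succ_le_of_lt hn)]
    refine forall₃_congr fun d v hv => ?_
    rw [sum_koszul_smul_insertFirst_twist hg hv, smul_eq_zero_iff_eq]

lemma isShiftedLInf_twist (L : LInfStructure 𝒱) : IsShiftedLInf (desusp 𝒱) (twist 𝒱 L.l) where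
  degree := (hasDegree_twist_iff L.l).mpr L.degree
  symm := (isGradedSymm_twist_iff L.l).mpr L.antisymm
  jacobi := (twist_jacobi_iff L.degree).mpr L.jacobi

/-- The décalage isomorphism between `L∞`-algebra structures on `V` and `L∞[1]`-algebra structures
on `↓V`. -/
def lInfEquivShiftedLInf : LInfStructure 𝒱 ≃ {f // IsShiftedLInf (desusp 𝒱) f} where
  toFun L := ⟨twist 𝒱 L.l, isShiftedLInf_twist L⟩
  invFun f :=
    have hf : IsShiftedLInf (desusp 𝒱) (twist 𝒱 (twist 𝒱 f.1)) := by
      rw [twist_twist]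
      exact f.2
    have degree := (hasDegree_twist_iff _).mp hf.degree
    { l := twist 𝒱 f.1
      degree := degree
      antisymm := (isGradedSymm_twist_iff _).mp hf.symm
      jacobi := (twist_jacobi_iff degree).mp hf.jacobi }
  left_inv L := LInfStructure.ext (twist_twist L.l)
  right_inv f := Subtype.ext (twist_twist f.1)

end correspondence

end LInfty

end

theorem mainTheorem8 {K : Type*} [Field K] [CharZero K] {V : Type*} [AddCommGroup V] [Module K V]
    (𝒱 : ℤ → Submodule K V) [DirectSum.Decomposition 𝒱] :
    ∃ Φ : LInfty.LInfStructure 𝒱 ≃ LInfty.CoDiff (LInfty.desusp 𝒱),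
      ∀ (L : LInfty.LInfStructure 𝒱) (n : ℕ+) (d : Fin n → ℤ) (v : Fin n → V),
        (∀ a, v a ∈ 𝒱 (d a)) →
        L.l n v = (-1 : ℤˣ) ^ (((n : ℕ) + 1).choose 2) • LInfty.desuspSign d •
          LInfty.corestriction (LInfty.desusp 𝒱) (Φ L : _ →ₗ[K] _) n v := by
  let Ψ := LInfty.coDiffEquivShiftedLInf (LInfty.desusp 𝒱)
  refine ⟨LInfty.lInfEquivShiftedLInf.trans Ψ.symm, fun L n d v hv => ?_⟩
  have corestriction_eq : LInfty.corestriction (LInfty.desusp 𝒱)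
      (Ψ.symm (LInfty.lInfEquivShiftedLInf L)).1 = LInfty.twist 𝒱 L.l :=
    congrArg Subtype.val (Ψ.apply_symm_apply (LInfty.lInfEquivShiftedLInf L))
  rw [Equiv.trans_apply, corestriction_eq, LInfty.twist_apply L.l n hv, LInfty.twistSign, smul_smul,
    smul_smul, Int.units_mul_self, one_smul]
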